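/- Let $W$ be a finite Coxeter group of rank $n$, realized as a finite group generated by orthogonal reflections of a Euclidean space $V$ of dimension $n$ such that no nonzero vector is fixed by all of $W$. Let $\mathcal{L}$ be its intersection lattice, i.e. the set of all intersections of reflecting hyperplanes of $W$ (including the empty intersection $V$), ordered by reverse inclusion, so that $V$ is the minimum and $\{0\}$ the maximum; let $\mu$ be the Möbius function of $\mathcal{L}$ and write $\mu(X)=\mu(X,\{0\})$. For $X\in\mathcal{L}$ let $W_X=\{w\in W : w(v)=v \text{ for all } v\in X\}$ be the corresponding parabolic subgroup, and let $\varphi_X=\operatorname{Ind}_{W_X}^{W}\mathbf{1}$ be the character of $W$ induced from the trivial character of $W_X$. Let $\mathcal{P}=\{wW_X : w\in W,\ X\in\mathcal{L}\}$ be the poset of parabolic cosets ordered by inclusion, on which $W$ acts by left multiplication, and let $\bar{\mathcal{P}}=\mathcal{P}\setminus\{W\}$. Let $\xi$ be the character of $W$ acting on the reduced homology $\tilde H_{n-1}(\bar{\mathcal{P}})$, with complex coefficients, of the order complex of $\bar{\mathcal{P}}$. Then $$\xi=(-1)^n\sum_{X\in\mathcal{L}}\mu(X)\,\varphi_X .$$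 Moreover, for every set $\Theta$ of representatives of the orbits of $W$ acting on $\mathcal{L}$, $$\xi=(-1)^n\sum_{X\in\Theta}\mu(X)\,[W:N(W_X)]\,\varphi_X ,$$ where $N(W_X)$ is the normalizer of $W_X$ in $W$. -/

import Mathlib

open scoped Pointwise

/-! ## Reduced homology of the order complex of a poset

The simplices of the order complex of a poset `P` are the finite chains of `P`; a chain with `k`
elements `x₀ < ⋯ < x_{k-1}` is a simplex of dimension `k - 1`. Everything is indexed by the number
`k : ℕ` of vertices, i.e. by the homological degree plus one, so that the empty chain
(degree `-1`, the augmentation) is the case `k = 0`. -/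

namespace OrderComplex

/-- The chains `x₀ < ⋯ < x_{k-1}` with `k` elements in `P`, i.e. the `(k-1)`-dimensional simplices
of the order complex of `P` (including the empty simplex for `k = 0`). -/
abbrev Simplex (P : Type*) [PartialOrder P] (k : ℕ) : Type _ := Fin k ↪o P

/-- The face of a simplex obtained by deleting the vertex `x_i`. -/
def face {P : Type*} [PartialOrder P] {k : ℕ} (i : Fin (k + 1)) (c : Simplex P (k + 1)) :
    Simplex P k :=
  (Fin.succAboveOrderEmb i).trans c

/-- The module of simplicial chains of degree `k - 1` with coefficients in `R`. -/
abbrev Chains (R : Type*) [CommRing R] (P : Type*) [PartialOrder P] (k : ℕ) :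
    Type _ :=
  Simplex P k →₀ R

/-- The simplicial boundary `∂ (x₀ < ⋯ < x_k) = ∑ i, (-1)^i (x₀ < ⋯ < x̂_i < ⋯ < x_k)`, from degree
`k` to degree `k - 1`. For `k = 0` it is the augmentation. -/
noncomputable def boundary (R : Type*) [CommRing R] (P : Type*) [PartialOrder P] (k : ℕ) :
    Chains R P (k + 1) →ₗ[R] Chains R P k :=
  ∑ i : Fin (k + 1), (-1 : R) ^ (i : ℕ) • Finsupp.lmapDomain R R (face i)

theorem boundary_single (R : Type*) [CommRing R] {P : Type*} [PartialOrder P] (k : ℕ)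
    (c : Simplex P (k + 1)) (a : R) :
    boundary R P k (Finsupp.single c a) =
      ∑ i : Fin (k + 1), (-1 : R) ^ (i : ℕ) • Finsupp.single (face i c) a := by
  simp [boundary, LinearMap.sum_apply]

theorem face_face {P : Type*} [PartialOrder P] {k : ℕ} (c : Simplex P (k + 2))
    (i : Fin (k + 1)) (j : Fin (k + 2)) (h : (j : ℕ) ≤ i) :
    face i (face j c) = face (j.castLT (by omega)) (face i.succ c) := by
  ext x
  simp only [face, RelEmbedding.coe_trans, Function.comp_apply, Fin.succAboveOrderEmb_apply]
  congr 1
  ext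
  simp only [Fin.succAbove, Fin.lt_def, Fin.val_castSucc, Fin.val_succ, Fin.val_castLT]
  split_ifs <;> simp_all <;> omega

/-- `∂ ∘ ∂ = 0`. -/
theorem boundary_boundary (R : Type*) [CommRing R] (P : Type*) [PartialOrder P] (k : ℕ) :
    boundary R P k ∘ₗ boundary R P (k + 1) = 0 := by
  refine Finsupp.lhom_ext fun c a => ?_
  simp only [LinearMap.comp_apply, boundary_single, map_sum, map_smul, Finset.smul_sum, smul_smul,
    LinearMap.zero_apply]
  rw [← Finset.sum_product', Finset.univ_product_univ]
  let S : Finset (Fin (k + 2) × Fin (k + 1)) := {ij | (ij.1 : ℕ) ≤ ij.2}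
  rw [← Finset.sum_add_sum_compl S, ← eq_neg_iff_add_eq_zero, ← Finset.sum_neg_distrib]
  let φ : ∀ ij : Fin (k + 2) × Fin (k + 1), ij ∈ S → Fin (k + 2) × Fin (k + 1) := fun ij hij =>
    (ij.2.succ, Fin.castLT ij.1 (lt_of_le_of_lt (Finset.mem_filter.mp hij).right (Fin.is_lt ij.2)))
  refine Finset.sum_bij φ ?_ ?_ ?_ ?_
  · intro ij hij
    simp_rw [S, φ, Finset.compl_filter, Finset.mem_filter_univ, Fin.val_succ,
      Fin.val_castLT] at hij ⊢
    omega
  · rintro ⟨i, j⟩ hij ⟨i', j'⟩ hij' h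
    simp only [φ, Prod.mk.injEq, Fin.ext_iff, Fin.val_succ, Fin.val_castLT] at h
    ext <;> simp <;> omega
  · rintro ⟨i', j'⟩ hij'
    simp_rw [S, Finset.compl_filter, Finset.mem_filter_univ, not_le] at hij'
    refine ⟨(j'.castSucc, i'.pred ?_), ?_, ?_⟩
    · rintro rfl
      simp at hij'
    · simp only [S, Finset.mem_filter_univ, Fin.val_castSucc, Fin.val_pred]
      omega
    · simp only [φ, Fin.castLT_castSucc, Fin.succ_pred]
  · rintro ⟨i, j⟩ hij
    have h : (i : ℕ) ≤ j := by simpa [S] using hij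
    simp only [φ, face_face c j i h, Fin.val_succ, Fin.val_castLT, ← neg_smul]
    congr 1
    ring

/-- The cycles of degree `k - 1` in the augmented chain complex (the chain group of degree `-2` is
zero, so every chain of degree `-1` is a cycle). -/
noncomputable def cycles (R : Type*) [CommRing R] (P : Type*) [PartialOrder P] :
    (k : ℕ) → Submodule R (Chains R P k)
  | 0 => ⊤
  | k + 1 => LinearMap.ker (boundary R P k)

/-- The boundaries of degree `k - 1`. -/
noncomputable def boundaries (R : Type*) [CommRing R] (P : Type*) [PartialOrder P] (k : ℕ) :
    Submodule R (Chains R P k) :=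
  LinearMap.range (boundary R P k)

theorem boundaries_le_cycles (R : Type*) [CommRing R] (P : Type*) [PartialOrder P] (k : ℕ) :
    boundaries R P k ≤ cycles R P k := by
  cases k with
  | zero => exact le_top
  | succ k =>
    rintro _ ⟨x, rfl⟩
    exact LinearMap.congr_fun (boundary_boundary R P k) x

/-- The quotient `Z / (B ∩ Z)` of two submodules; below always `B ≤ Z`. -/
abbrev Subquotient {R M : Type*} [CommRing R] [AddCommGroup M] [Module R M]
    (Z B : Submodule R M) : Type _ :=
  Z ⧸ B.submoduleOf Z

/-- The map `[z] ↦ [f z]` on `Z / B` induced by a linear map preserving `Z` and `B`. -/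
def Subquotient.map {R M : Type*} [CommRing R] [AddCommGroup M] [Module R M]
    {Z B : Submodule R M} (f : M →ₗ[R] M) (hZ : ∀ x ∈ Z, f x ∈ Z) (hB : ∀ x ∈ B, f x ∈ B) :
    Subquotient Z B →ₗ[R] Subquotient Z B :=
  Submodule.mapQ _ _ (f.restrict hZ) fun x hx => hB x hx

/-- The reduced simplicial homology `H̃_{k-1}(Δ(P); R)` of the order complex of `P`. -/
abbrev ReducedHomology (R : Type*) [CommRing R] (P : Type*) [PartialOrder P] (k : ℕ) : Type _ :=
  Subquotient (cycles R P k) (boundaries R P k)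

/-- The map on chains induced by an automorphism of the poset. -/
noncomputable def chainMap (R : Type*) [CommRing R] {P : Type*} [PartialOrder P] (k : ℕ)
    (e : P ≃o P) :
    Chains R P k →ₗ[R] Chains R P k :=
  Finsupp.lmapDomain R R fun c : Simplex P k => c.trans e.toOrderEmbedding

theorem boundary_chainMap (R : Type*) [CommRing R] {P : Type*} [PartialOrder P] (k : ℕ)
    (e : P ≃o P)
    (x : Chains R P (k + 1)) :
    boundary R P k (chainMap R (k + 1) e x) = chainMap R k e (boundary R P k x) := by
  suffices h : boundary R P k ∘ₗ chainMap R (k + 1) e = chainMap R k e ∘ₗ boundary R P k from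
    LinearMap.congr_fun h x
  refine Finsupp.lhom_ext fun c a => ?_
  simp only [LinearMap.comp_apply, chainMap, Finsupp.lmapDomain_apply, Finsupp.mapDomain_single,
    boundary_single, Finsupp.mapDomain_finsetSum, Finsupp.mapDomain_smul]
  rfl

theorem chainMap_one (R : Type*) [CommRing R] {P : Type*} [PartialOrder P] (k : ℕ) :
    chainMap R k (1 : P ≃o P) = LinearMap.id :=
  Finsupp.lmapDomain_id R R

theorem chainMap_mul (R : Type*) [CommRing R] {P : Type*} [PartialOrder P] (k : ℕ)
    (e f : P ≃o P) :
    chainMap R k (e * f) = chainMap R k e ∘ₗ chainMap R k f :=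
  Finsupp.lmapDomain_comp R R (fun c : Simplex P k => c.trans f.toOrderEmbedding)
    (fun c : Simplex P k => c.trans e.toOrderEmbedding)

theorem chainMap_mem_cycles (R : Type*) [CommRing R] {P : Type*} [PartialOrder P] (k : ℕ)
    (e : P ≃o P) :
    ∀ x ∈ cycles R P k, chainMap R k e x ∈ cycles R P k := by
  cases k with
  | zero => exact fun _ _ => Submodule.mem_top
  | succ k =>
    intro x hx
    have hx' : boundary R P k x = 0 := hx
    change boundary R P k _ = 0
    rw [boundary_chainMap, hx', map_zero]

theorem chainMap_mem_boundaries (R : Type*) [CommRing R] {P : Type*} [PartialOrder P] (k : ℕ)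
    (e : P ≃o P) :
    ∀ x ∈ boundaries R P k, chainMap R k e x ∈ boundaries R P k := by
  rintro _ ⟨y, rfl⟩
  exact ⟨chainMap R (k + 1) e y, boundary_chainMap R k e y⟩

/-- The map on reduced homology induced by an automorphism of the poset: `[z] ↦ [e z]`. -/
noncomputable def homologyMap (R : Type*) [CommRing R] {P : Type*} [PartialOrder P] (k : ℕ)
    (e : P ≃o P) :
    ReducedHomology R P k →ₗ[R] ReducedHomology R P k :=
  Subquotient.map (chainMap R k e) (chainMap_mem_cycles R k e) (chainMap_mem_boundaries R k e)

/-- The natural representation of the automorphism group of `P` on `H̃_{k-1}(Δ(P); R)`. -/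
noncomputable def homologyRep (R : Type*) [CommRing R] (P : Type*) [PartialOrder P] (k : ℕ) :
    Representation R (P ≃o P) (ReducedHomology R P k) where
  toFun e := homologyMap R k e
  map_one' := by
    refine Submodule.linearMap_qext _ (LinearMap.ext fun x => ?_)
    refine congrArg (Submodule.Quotient.mk) (Subtype.ext ?_)
    exact LinearMap.congr_fun (chainMap_one R k) x.1
  map_mul' e f := by
    refine Submodule.linearMap_qext _ (LinearMap.ext fun x => ?_)
    refine congrArg (Submodule.Quotient.mk) (Subtype.ext ?_)
    exact LinearMap.congr_fun (chainMap_mul R k e f) x.1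

end OrderComplex

/-! ## Finite real reflection groups, intersection lattice, parabolic cosets -/

namespace ReflectionGroup

variable {V : Type*} [NormedAddCommGroup V] [InnerProductSpace ℝ V]

/-- `t` is the orthogonal reflection in a hyperplane. -/
def IsReflection (t : V ≃ₗᵢ[ℝ] V) : Prop :=
  ∃ v : V, v ≠ 0 ∧ t = (ℝ ∙ v)ᗮ.reflection

/-- `W` is generated by reflections and acts essentially (no nonzero vector is fixed by all of `W`).
The finite such groups are the finite Coxeter groups in their geometric realization, of rank
`dim V`. -/
structure IsEssentialReflectionGroup (W : Subgroup (V ≃ₗᵢ[ℝ] V)) : Prop where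
  generated : Subgroup.closure {t : V ≃ₗᵢ[ℝ] V | t ∈ W ∧ IsReflection t} = W
  essential : ∀ v : V, (∀ w ∈ W, w v = v) → v = 0

/-- The fixed subspace of `w`. -/
def fix (w : V ≃ₗᵢ[ℝ] V) : Submodule ℝ V where
  carrier := {v | w v = v}
  add_mem' {a b} ha hb := by
    change w (a + b) = a + b
    rw [map_add, show w a = a from ha, show w b = b from hb]
  zero_mem' := map_zero w
  smul_mem' c x hx := by
    change w (c • x) = c • x
    rw [map_smul, show w x = x from hx]

/-- The reflecting hyperplanes of `W`. -/
def hyperplanes (W : Subgroup (V ≃ₗᵢ[ℝ] V)) : Set (Submodule ℝ V) :=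
  {H | ∃ t ∈ W, IsReflection t ∧ H = fix t}

/-- The intersection lattice of `W`: all intersections of sets of reflecting hyperplanes, the empty
intersection being `V`. -/
@[ext]
structure IntersectionLattice (W : Subgroup (V ≃ₗᵢ[ℝ] V)) where
  /-- the underlying subspace -/
  space : Submodule ℝ V
  exists_eq_sInf : ∃ S ⊆ hyperplanes W, space = sInf S

namespace IntersectionLattice

variable {W : Subgroup (V ≃ₗᵢ[ℝ] V)}

theorem space_injective :
    Function.Injective (space : IntersectionLattice W → Submodule ℝ V) :=
  fun _ _ h => IntersectionLattice.ext h

/-- The order is reverse inclusion of subspaces: `V` is the minimum, `{0}` the maximum. -/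
instance : PartialOrder (IntersectionLattice W) :=
  PartialOrder.lift (fun X => OrderDual.toDual X.space)
    fun _ _ h => space_injective (OrderDual.toDual.injective h)

theorem le_iff (X Y : IntersectionLattice W) : X ≤ Y ↔ Y.space ≤ X.space := Iff.rfl

instance [Finite W] : Finite (IntersectionLattice W) := by
  have h1 : (hyperplanes W).Finite := by
    refine (Set.finite_range fun w : W => fix (w : V ≃ₗᵢ[ℝ] V)).subset ?_
    rintro H ⟨t, ht, -, rfl⟩
    exact ⟨⟨t, ht⟩, rfl⟩
  have h2 : (sInf '' {S : Set (Submodule ℝ V) | S ⊆ hyperplanes W}).Finite :=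
    h1.finite_subsets.image _
  have : Finite (sInf '' {S : Set (Submodule ℝ V) | S ⊆ hyperplanes W}) := h2
  exact Finite.of_injective
    (fun X : IntersectionLattice W => (⟨X.space, by
      obtain ⟨S, hS, h⟩ := X.exists_eq_sInf
      exact ⟨S, hS, h.symm⟩⟩ : sInf '' {S : Set (Submodule ℝ V) | S ⊆ hyperplanes W}))
    fun X Y h => space_injective (congrArg Subtype.val h)

noncomputable instance [Finite W] : Fintype (IntersectionLattice W) := Fintype.ofFinite _

open scoped Classical in
noncomputable instance [Finite W] : LocallyFiniteOrder (IntersectionLattice W) :=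
  Fintype.toLocallyFiniteOrder

/-- The element `{0}` of the intersection lattice. -/
def zero (hW : IsEssentialReflectionGroup W) : IntersectionLattice W where
  space := ⊥
  exists_eq_sInf := by
    refine ⟨hyperplanes W, subset_rfl, (eq_bot_iff.2 fun v hv => ?_).symm⟩
    refine (Submodule.mem_bot ℝ).2 (hW.essential v fun w hw => ?_)
    rw [← hW.generated] at hw
    induction hw using Subgroup.closure_induction with
    | mem t ht => exact (Submodule.mem_sInf.1 hv) (fix t) ⟨t, ht.1, ht.2, rfl⟩
    | one => rfl
    | mul x y _ _ hx hy => change x (y v) = v; rw [hy, hx]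
    | inv x _ hx =>
      calc x⁻¹ v = x⁻¹ (x v) := by rw [hx]
        _ = v := x.symm_apply_apply v

/-- `μ(X) = μ(X, {0})`, with `μ` the Möbius function of the intersection lattice. -/
noncomputable def moebius [Finite W] (hW : IsEssentialReflectionGroup W) (X : IntersectionLattice W) :
    ℤ := by
  classical exact IncidenceAlgebra.mu ℤ X (zero hW)

/-- The parabolic subgroup `W_X = {w ∈ W | X ⊆ Fix w}`. -/
def parabolic (X : IntersectionLattice W) : Subgroup W where
  carrier := {w | X.space ≤ fix (w : V ≃ₗᵢ[ℝ] V)}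
  one_mem' := fun _ _ => rfl
  mul_mem' {a b} ha hb := fun v hv => by
    change (a : V ≃ₗᵢ[ℝ] V) ((b : V ≃ₗᵢ[ℝ] V) v) = v
    rw [show (b : V ≃ₗᵢ[ℝ] V) v = v from hb hv, show (a : V ≃ₗᵢ[ℝ] V) v = v from ha hv]
  inv_mem' {a} ha := fun v hv => by
    have h : (a : V ≃ₗᵢ[ℝ] V) v = v := ha hv
    change (a : V ≃ₗᵢ[ℝ] V).symm v = v
    rw [LinearIsometryEquiv.symm_apply_eq, h]

/-- `φ_X = Ind_{W_X}^W 1`, the character of `W` induced from the trivial character of `W_X`. -/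
noncomputable def phi (X : IntersectionLattice W) : W → ℂ :=
  (Representation.ind X.parabolic.subtype
    (Representation.trivial ℂ X.parabolic ℂ)).character

/-- `Θ` is a set of representatives for the orbits of `W` acting on the intersection lattice. -/
def IsOrbitTransversal (Θ : Finset (IntersectionLattice W)) : Prop :=
  ∀ X : IntersectionLattice W, ∃! Y : IntersectionLattice W, Y ∈ Θ ∧
    ∃ w ∈ W, Y.space = X.space.map (w.toLinearEquiv : V →ₗ[ℝ] V)

end IntersectionLattice

/-- The parabolic coset poset of `W`: the cosets `w W_X`, ordered by inclusion. -/
abbrev CosetPoset (W : Subgroup (V ≃ₗᵢ[ℝ] V)) : Type _ :=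
  {C : Set W // ∃ (w : W) (X : IntersectionLattice W), C = w • (X.parabolic : Set W)}

/-- The proper part of the parabolic coset poset, obtained by removing its maximum `W`. -/
abbrev ProperPart (W : Subgroup (V ≃ₗᵢ[ℝ] V)) : Type _ :=
  {C : CosetPoset W // C.1 ≠ Set.univ}

/-- Left multiplication by `w` on the proper part of the parabolic coset poset. -/
def leftMulFun {W : Subgroup (V ≃ₗᵢ[ℝ] V)} (w : W) (C : ProperPart W) : ProperPart W :=
  ⟨⟨w • C.1.1, by
    obtain ⟨u, X, h⟩ := C.1.2
    exact ⟨w * u, X, by rw [h, smul_smul]⟩⟩, fun h => C.2 <| by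
      have h' : w • C.1.1 = Set.univ := h
      rw [← inv_smul_smul w C.1.1, h', Set.smul_set_univ]⟩

/-- The action of `W` on the proper part of the parabolic coset poset by left multiplication. -/
def leftMul (W : Subgroup (V ≃ₗᵢ[ℝ] V)) : W →* (ProperPart W ≃o ProperPart W) where
  toFun w :=
    { toFun := leftMulFun w
      invFun := leftMulFun w⁻¹
      left_inv := fun C => Subtype.ext (Subtype.ext (inv_smul_smul w C.1.1))
      right_inv := fun C => Subtype.ext (Subtype.ext (smul_inv_smul w C.1.1))
      map_rel_iff' := Set.smul_set_subset_smul_set_iff }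
  map_one' := RelIso.ext fun C => Subtype.ext (Subtype.ext (one_smul W C.1.1))
  map_mul' u w := RelIso.ext fun C => Subtype.ext (Subtype.ext (mul_smul u w C.1.1))

/-- The character of `W` acting on the reduced homology `H̃_{k-1}` (with complex
coefficients) of the proper part of the parabolic coset poset. -/
noncomputable def homologyCharacter (W : Subgroup (V ≃ₗᵢ[ℝ] V)) (k : ℕ) : W → ℂ :=
  Representation.character ((OrderComplex.homologyRep ℂ (ProperPart W) k).comp (leftMul W))

end ReflectionGroup

/-! The cosets of parabolic subgroups are counted by a Hopf trace argument, once it is known that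
the reduced homology of the proper part `P` of their poset vanishes below degree `n - 1`.

**Vanishing.** The minimal elements of `P` are the elements `w` of `W`, and the upper set above `w`
is a copy of the proper part of the intersection lattice. Fix a vector `z` on no reflecting
hyperplane, and add these upper sets (cones, hence acyclic) one at a time, by decreasing
`⟨w z, z⟩`. The cone over `w` meets the cones added before it in the cosets `w W_X` on which `w` is
not the unique maximizer of this function. If `w` is not the unique maximizer, then some reflection
`t ∈ W_X` increases the value at `w` (`exists_refl_of_le`), so the intersection is the upper set
generated by certain covers `w W_H` of `w`, with `H` a reflecting hyperplane. Because two
hyperplanes of a subspace meet in codimension two, such an upper set is again handled by adding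
cones one at a time (`OrderComplex.acyclicOn_covers`). In both places the step is the Mayer–Vietoris
argument for two upper sets (`OrderComplex.AcyclicOn.union`).

The existence of `t` rests on the fact that an element of `W` fixing a vector on no reflecting
hyperplane is the identity (`eq_one_of_apply_eq_self`). It is obtained from a simple system by the
deletion property.

**Trace.** As the homology is concentrated in the top degree and there are no longer chains, the
trace of `w` on it is the alternating sum, over `k`, of the number of chains in `P` with `k`
elements fixed by `w` (`OrderComplex.trace_homologyMap`). Every coset above a fixed coset is fixed,
so a chain is fixed as soon as its least element is; and the alternating number of chains
starting at `u W_X` is `μ(X)`, by Philip Hall's theorem (`ProperPart.altChainCount_eq`). Finally,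
the number of cosets of `W_X` fixed by `w` is `φ_X(w)`, since `φ_X` is the permutation character
on `W ⧸ W_X` (`Representation.character_ind_trivial`).

**Orbits.** Both `μ` and `φ` are constant on the orbits of `W` on the intersection lattice, and the
stabilizer of `X` is the normalizer of `W_X`, so that the orbit of `X` has `[W : N(W_X)]`
elements. -/

/-! ### Roots, simple systems, and stabilizers of regular vectors -/

namespace ReflectionGroup

open scoped NNReal

variable {V : Type*} [NormedAddCommGroup V] [InnerProductSpace ℝ V]

/-- The orthogonal reflection in the hyperplane perpendicular to `v`. -/
noncomputable def refl (v : V) : V ≃ₗᵢ[ℝ] V := (ℝ ∙ v)ᗮ.reflection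

theorem refl_apply {v : V} (hv : ‖v‖ = 1) (x : V) :
    refl v x = x - (2 * inner ℝ v x) • v := by
  rw [refl, Submodule.reflection_orthogonal_apply, Submodule.reflection_singleton_apply, hv]
  simp only [RCLike.ofReal_real_eq_id, id, one_pow, div_one, neg_sub, two_smul, two_mul, add_smul]

theorem refl_self (v : V) : refl v v = -v :=
  Submodule.reflection_orthogonalComplement_singleton_eq_neg v

theorem refl_mul_refl (v : V) : refl v * refl v = 1 :=
  Submodule.reflection_mul_reflection _

theorem refl_refl (v x : V) : refl v (refl v x) = x :=
  Submodule.reflection_involutive _ x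

theorem refl_smul {c : ℝ} (hc : c ≠ 0) (v : V) : refl (c • v) = refl v := by
  unfold refl
  congr 1
  rw [Submodule.span_singleton_smul_eq (IsUnit.mk0 c hc)]

theorem refl_neg (v : V) : refl (-v) = refl v := by
  rw [← neg_one_smul ℝ v, refl_smul (by norm_num)]

theorem refl_eq_self_iff {v : V} (hv : ‖v‖ = 1) (x : V) : refl v x = x ↔ inner ℝ v x = 0 := by
  have : v ≠ 0 := by rintro rfl; simp at hv
  rw [refl_apply hv, sub_eq_self, smul_eq_zero]
  simp [this]

theorem conj_refl (w : V ≃ₗᵢ[ℝ] V) {v : V} (hv : ‖v‖ = 1) :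
    w * refl v * w⁻¹ = refl (w v) := by
  ext x
  obtain ⟨y, rfl⟩ := w.surjective x
  have hy : w⁻¹ (w y) = y := w.symm_apply_apply y
  rw [LinearIsometryEquiv.coe_mul, LinearIsometryEquiv.coe_mul, Function.comp_apply,
    Function.comp_apply, hy, refl_apply hv, refl_apply (by rw [w.norm_map, hv]), map_sub, map_smul,
    w.inner_map_map]

theorem eq_or_eq_neg_of_refl_eq {a b : V} (ha : ‖a‖ = 1) (hb : ‖b‖ = 1) (h : refl a = refl b) :
    b = a ∨ b = -a := by
  have h1 : refl a b = -b := by rw [h, refl_self]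
  rw [refl_apply ha, sub_eq_iff_eq_add] at h1
  have h2 : b = inner ℝ a b • a := by
    have : (2 : ℝ) • b = (2 : ℝ) • (inner ℝ a b • a) := by
      rw [smul_smul, ← sub_eq_zero, two_smul]
      nth_rewrite 1 [h1]
      abel
    exact smul_right_injective V (two_ne_zero : (2 : ℝ) ≠ 0) this
  have h3 : |inner ℝ a b| = 1 := by
    have := congrArg norm h2
    rw [norm_smul, ha, hb, mul_one, Real.norm_eq_abs] at this
    exact this.symm
  rcases (abs_eq zero_le_one).1 h3 with h4 | h4
  · left; rw [h2, h4, one_smul]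
  · right; rw [h2, h4, neg_one_smul]

/-- The roots of `W`, normalized to length one: the unit vectors `v` whose reflection belongs
to `W`. -/
def roots (W : Subgroup (V ≃ₗᵢ[ℝ] V)) : Set V :=
  {v | ‖v‖ = 1 ∧ refl v ∈ W}

variable {W : Subgroup (V ≃ₗᵢ[ℝ] V)}

theorem neg_mem_roots {a : V} (ha : a ∈ roots W) : -a ∈ roots W :=
  ⟨by rw [norm_neg, ha.1], by rw [refl_neg]; exact ha.2⟩

theorem map_mem_roots {w : V ≃ₗᵢ[ℝ] V} (hw : w ∈ W) {a : V} (ha : a ∈ roots W) :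
    w a ∈ roots W :=
  ⟨by rw [w.norm_map, ha.1], by
    rw [← conj_refl w ha.1]; exact W.mul_mem (W.mul_mem hw ha.2) (W.inv_mem hw)⟩

theorem finite_roots (W : Subgroup (V ≃ₗᵢ[ℝ] V)) [Finite W] : (roots W).Finite := by
  have hW : (W : Set (V ≃ₗᵢ[ℝ] V)).Finite := Set.toFinite _
  refine (hW.biUnion (t := fun t => {v : V | ‖v‖ = 1 ∧ refl v = t}) fun t _ => ?_).subset ?_
  · rcases Set.eq_empty_or_nonempty {v : V | ‖v‖ = 1 ∧ refl v = t} with h | ⟨a, ha⟩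
    · rw [h]; exact Set.finite_empty
    · refine (Set.toFinite {a, -a}).subset fun b hb => ?_
      exact eq_or_eq_neg_of_refl_eq ha.1 hb.1 (ha.2.trans hb.2.symm)
  · intro v hv
    exact Set.mem_biUnion (x := refl v) hv.2 ⟨hv.1, rfl⟩

theorem exists_root_of_isReflection {t : V ≃ₗᵢ[ℝ] V} (ht : t ∈ W) (h : IsReflection t) :
    ∃ a ∈ roots W, t = refl a := by
  obtain ⟨v, hv, rfl⟩ := h
  have hn : ‖v‖⁻¹ ≠ 0 := inv_ne_zero (norm_ne_zero_iff.2 hv)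
  have h' : refl (‖v‖⁻¹ • v) = (ℝ ∙ v)ᗮ.reflection := refl_smul hn v
  refine ⟨‖v‖⁻¹ • v, ⟨?_, ?_⟩, h'.symm⟩
  · rw [norm_smul, norm_inv, norm_norm, inv_mul_cancel₀ (norm_ne_zero_iff.2 hv)]
  · rw [h']; exact ht

theorem isReflection_refl {a : V} (ha : ‖a‖ = 1) : IsReflection (refl a) :=
  ⟨a, by rintro rfl; simp at ha, rfl⟩

/-- A finite set of linear forms, none of which vanishes on the subspace `p`, has a common
non-zero on `p`. -/
theorem exists_mem_forall_inner_ne_zero {S : Set V} (hS : S.Finite) (p : Submodule ℝ V)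
    (h : ∀ a ∈ S, ∃ x ∈ p, inner ℝ a x ≠ 0) : ∃ x ∈ p, ∀ a ∈ S, inner ℝ a x ≠ 0 := by
  have := hS.to_subtype
  obtain ⟨x, hx, h'⟩ := Module.Dual.exists_forall_mem_ne_zero_of_forall_exists p
    (fun a : S => (innerₛₗ ℝ (a : V) : V →ₗ[ℝ] ℝ)) fun a => h a a.2
  exact ⟨x, hx, fun a ha => h' ⟨a, ha⟩⟩

/-- The roots that are positive on `z`. -/
def posRoots (W : Subgroup (V ≃ₗᵢ[ℝ] V)) (z : V) : Set V :=
  {a | a ∈ roots W ∧ 0 < inner ℝ a z}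

/-- A simple system for the positive roots determined by `z`: a minimal set of positive roots
whose convex cone contains all of them. -/
structure IsSimpleSystem (W : Subgroup (V ≃ₗᵢ[ℝ] V)) (z : V) (D : Set V) : Prop where
  subset : D ⊆ posRoots W z
  span : posRoots W z ⊆ Submodule.span ℝ≥0 D
  minimal : ∀ a ∈ D, a ∉ Submodule.span ℝ≥0 (D \ {a})

theorem exists_isSimpleSystem (W : Subgroup (V ≃ₗᵢ[ℝ] V)) [Finite W] (z : V) :
    ∃ D, IsSimpleSystem W z D := by
  have hfin : (posRoots W z).Finite := (finite_roots W).subset fun _ h => h.1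
  obtain ⟨D, ⟨hD1, hD2⟩, hD3⟩ := Set.Finite.exists_minimal
    (s := {D | D ⊆ posRoots W z ∧ posRoots W z ⊆ Submodule.span ℝ≥0 D})
    (hfin.finite_subsets.subset fun D hD => hD.1) ⟨_, subset_rfl, Submodule.subset_span⟩
  refine ⟨D, hD1, hD2, fun a ha ha' => ?_⟩
  have h : D ⊆ D \ {a} := by
    refine hD3 ⟨Set.sdiff_subset.trans hD1, hD2.trans ?_⟩ Set.sdiff_subset
    refine Submodule.span_le.2 fun b hb => ?_
    by_cases hba : b = a
    · rw [hba]; exact ha'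
    · exact Submodule.subset_span ⟨hb, hba⟩
  exact (h ha).2 rfl

/-- A nonzero element of the cone spanned by positive roots is positive on `z`. -/
theorem eq_zero_or_pos_of_mem_span {z : V} {D : Set V} (hD : D ⊆ posRoots W z) {x : V}
    (hx : x ∈ Submodule.span ℝ≥0 D) : x = 0 ∨ 0 < inner ℝ x z := by
  induction hx using Submodule.span_induction with
  | mem x hx => exact Or.inr (hD hx).2
  | zero => exact Or.inl rfl
  | add x y _ _ hx hy =>
    rcases hx with rfl | hx
    · simpa using hy
    · rcases hy with rfl | hy
      · simpa using Or.inr hx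
      · right; rw [inner_add_left]; positivity
  | smul c x _ hx =>
    rcases hx with rfl | hx
    · simp
    · rcases eq_or_ne c 0 with rfl | hc
      · simp
      · right
        rw [NNReal.smul_def, real_inner_smul_left]
        have : 0 < (c : ℝ) := by positivity
        positivity

/-- A linear form that is nonnegative on `D` is nonnegative on the cone spanned by `D`. -/
theorem inner_nonneg_of_mem_span {D : Set V} {y x : V} (h : ∀ a ∈ D, 0 ≤ inner ℝ a y)
    (hx : x ∈ Submodule.span ℝ≥0 D) : 0 ≤ inner ℝ x y := by
  induction hx using Submodule.span_induction with
  | mem x hx => exact h x hx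
  | zero => simp
  | add x y _ _ hx hy => rw [inner_add_left]; positivity
  | smul c x _ hx => rw [NNReal.smul_def, real_inner_smul_left]; positivity

theorem eq_of_eq_smul {a b z : V} (ha : a ∈ posRoots W z) (hb : b ∈ posRoots W z) {c : ℝ≥0}
    (h : b = c • a) : b = a := by
  have h1 : (c : ℝ) = 1 := by
    have := congrArg norm h
    rw [NNReal.smul_def, norm_smul, ha.1.1, hb.1.1, mul_one] at this
    simpa using this.symm
  rw [h, NNReal.smul_def, h1, one_smul]

/-- The product of the reflections in a list of roots. -/
noncomputable def reflProd (l : List V) : V ≃ₗᵢ[ℝ] V :=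
  (l.map refl).prod

theorem reflProd_mem {l : List V} (h : ∀ a ∈ l, a ∈ roots W) :
    reflProd l ∈ W :=
  Subgroup.list_prod_mem _ fun x hx => by
    obtain ⟨a, ha, rfl⟩ := List.mem_map.1 hx
    exact (h a ha).2

namespace IsSimpleSystem

variable {z : V} {D : Set V}

/-- The reflection in a simple root permutes the other positive roots. -/
theorem refl_mem_posRoots (hD : IsSimpleSystem W z D) (hz : ∀ a ∈ roots W, inner ℝ a z ≠ 0)
    {a : V} (ha : a ∈ D) {c : V} (hc : c ∈ posRoots W z) (hca : c ≠ a) :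
    refl a c ∈ posRoots W z := by
  have ha' := hD.subset ha
  have hins : insert a (D \ {a}) = D := Set.insert_sdiff_self_of_mem ha
  have hroot : refl a c ∈ roots W := map_mem_roots ha'.1.2 hc.1
  refine ⟨hroot, (hz _ hroot).lt_or_gt.resolve_left fun hneg => ?_⟩
  have hd : -refl a c ∈ posRoots W z :=
    ⟨neg_mem_roots hroot, by rw [inner_neg_left]; linarith⟩
  have h1 := hD.span hc
  have h2 := hD.span hd
  rw [← hins, SetLike.mem_coe, Submodule.mem_span_insert] at h1 h2
  obtain ⟨p, y, hy, h1⟩ := h1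
  obtain ⟨q, y', hy', h2⟩ := h2
  have h3 : y + y' = (2 * inner ℝ a c - p - q : ℝ) • a := by
    have h4 : c + -refl a c = (2 * inner ℝ a c) • a := by rw [refl_apply ha'.1.1]; abel
    rw [h2] at h4
    nth_rewrite 1 [h1] at h4
    rw [sub_smul, sub_smul, ← h4, NNReal.smul_def, NNReal.smul_def]
    abel
  have hsub : D \ {a} ⊆ posRoots W z := Set.sdiff_subset.trans hD.subset
  rcases lt_or_ge 0 (2 * inner ℝ a c - p - q : ℝ) with hk | hk
  · refine hD.minimal a ha ?_
    have h5 := Submodule.smul_mem _ (Real.toNNReal (2 * inner ℝ a c - p - q))⁻¹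
      (Submodule.add_mem _ hy hy')
    rwa [h3, NNReal.smul_def, NNReal.coe_inv, Real.coe_toNNReal _ hk.le, smul_smul,
      inv_mul_cancel₀ hk.ne', one_smul] at h5
  · have h5 : inner ℝ (y + y') z ≤ 0 := by
      rw [h3, real_inner_smul_left]
      exact mul_nonpos_of_nonpos_of_nonneg hk ha'.2.le
    have h6 : y = 0 := by
      rcases eq_zero_or_pos_of_mem_span hsub hy with h | h
      · exact h
      · rw [inner_add_left] at h5
        rcases eq_zero_or_pos_of_mem_span hsub hy' with h' | h'
        · rw [h', inner_zero_left] at h5; linarith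
        · linarith
    rw [h6, add_zero] at h1
    exact hca (eq_of_eq_smul ha' hc h1)

/-- Every positive root is conjugate to a simple one by a product of simple reflections. A
conjugate of least height `⟨·, z⟩` is simple, since otherwise some simple reflection would
lower it further. -/
theorem exists_reflProd_apply_mem [Finite W] (hD : IsSimpleSystem W z D)
    (hz : ∀ a ∈ roots W, inner ℝ a z ≠ 0) {c : V} (hc : c ∈ posRoots W z) :
    ∃ w ∈ Subgroup.closure (refl '' D), w c ∈ D := by
  let S : Set V := {d | d ∈ posRoots W z ∧ ∃ w ∈ Subgroup.closure (refl '' D), w c = d}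
  have hS : S.Finite := (finite_roots W).subset fun d hd => hd.1.1
  obtain ⟨d, ⟨hd, w, hw, hwc⟩, hmin⟩ :=
    Set.exists_min_image S (fun d => inner ℝ d z) hS ⟨c, hc, 1, one_mem _, rfl⟩
  refine ⟨w, hw, ?_⟩
  rw [hwc]
  by_contra hdD
  obtain ⟨a, ha, had⟩ : ∃ a ∈ D, 0 < inner ℝ a d := by
    by_contra! hcon
    have h1 : 0 ≤ inner ℝ d (-d) := inner_nonneg_of_mem_span (D := D)
      (fun a ha => by rw [inner_neg_right]; linarith [hcon a ha]) (hD.span hd)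
    rw [inner_neg_right, real_inner_self_eq_norm_sq, hd.1.1] at h1
    norm_num at h1
  have h2 := hD.refl_mem_posRoots hz ha hd (by rintro rfl; exact hdD ha)
  have h3 := hmin (refl a d) ⟨h2, refl a * w,
    mul_mem (Subgroup.subset_closure ⟨a, ha, rfl⟩) hw, by rw [← hwc]; rfl⟩
  rw [refl_apply (hD.subset ha).1.1, inner_sub_left, real_inner_smul_left] at h3
  have := mul_pos had (hD.subset ha).2
  nlinarith

theorem closure_refl_eq [Finite W] (hW : Subgroup.closure {t | t ∈ W ∧ IsReflection t} = W)
    (hD : IsSimpleSystem W z D) (hz : ∀ a ∈ roots W, inner ℝ a z ≠ 0) :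
    W ≤ Subgroup.closure (refl '' D) := by
  rw [← hW, Subgroup.closure_le]
  have key : ∀ c ∈ posRoots W z, refl c ∈ Subgroup.closure (refl '' D) := by
    intro c hc
    obtain ⟨w, hw, hwc⟩ := hD.exists_reflProd_apply_mem hz hc
    have h1 : refl c = w⁻¹ * refl (w c) * w := by
      rw [← conj_refl w hc.1.1]; group
    rw [h1]
    exact mul_mem (mul_mem (inv_mem hw) (Subgroup.subset_closure ⟨_, hwc, rfl⟩)) hw
  rintro t ⟨ht, ht'⟩
  obtain ⟨a, ha, rfl⟩ := exists_root_of_isReflection ht ht'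
  rcases (hz a ha).lt_or_gt with h | h
  · rw [← refl_neg]
    exact key _ ⟨neg_mem_roots ha, by rw [inner_neg_left]; linarith⟩
  · exact key _ ⟨ha, h⟩

theorem exists_list [Finite W] (hW : Subgroup.closure {t | t ∈ W ∧ IsReflection t} = W)
    (hD : IsSimpleSystem W z D) (hz : ∀ a ∈ roots W, inner ℝ a z ≠ 0)
    {w : V ≃ₗᵢ[ℝ] V} (hw : w ∈ W) : ∃ l : List V, (∀ a ∈ l, a ∈ D) ∧ reflProd l = w := by
  have step : ∀ (a : V) (_ : a ∈ D) (y : V ≃ₗᵢ[ℝ] V),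
      (∃ l : List V, (∀ a ∈ l, a ∈ D) ∧ reflProd l = y) →
      ∃ l : List V, (∀ a ∈ l, a ∈ D) ∧ reflProd l = refl a * y := by
    rintro a ha y ⟨l, hl, rfl⟩
    exact ⟨a :: l, by simpa using ⟨ha, hl⟩, by simp [reflProd]⟩
  replace hw := hD.closure_refl_eq hW hz hw
  induction hw using Subgroup.closure_induction_left with
  | one => exact ⟨[], by simp, rfl⟩
  | mul_left x hx y _ ih =>
    obtain ⟨a, ha, rfl⟩ := hx
    exact step a ha y ih
  | inv_mul_cancel x hx y _ ih =>
    obtain ⟨a, ha, rfl⟩ := hx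
    rw [inv_eq_of_mul_eq_one_left (refl_mul_refl a)]
    exact step a ha y ih

/-- The deletion property: if a word in simple reflections sends the simple root `a` to a
negative root, then multiplying it by the reflection in `a` amounts to deleting one letter. -/
theorem exists_delete (hD : IsSimpleSystem W z D) (hz : ∀ a ∈ roots W, inner ℝ a z ≠ 0)
    {a : V} (ha : a ∈ D) (l : List V) (hl : ∀ b ∈ l, b ∈ D)
    (hneg : inner ℝ (reflProd l a) z < 0) :
    ∃ l' : List V, (∀ b ∈ l', b ∈ D) ∧ l'.length + 1 = l.length ∧
      reflProd l' = reflProd l * refl a := by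
  induction l with
  | nil =>
    have : 0 < inner ℝ a z := (hD.subset ha).2
    have h0 : reflProd ([] : List V) a = a := rfl
    rw [h0] at hneg
    linarith
  | cons b l ih =>
    simp only [List.mem_cons, forall_eq_or_imp] at hl
    obtain ⟨hb, hl⟩ := hl
    have hcons : ∀ l : List V, reflProd (b :: l) = refl b * reflProd l := fun l => by
      simp [reflProd]
    have hroot : reflProd l a ∈ roots W :=
      map_mem_roots (reflProd_mem fun c hc => (hD.subset (hl c hc)).1) (hD.subset ha).1
    rcases (hz _ hroot).lt_or_gt with h | h
    · obtain ⟨l', h1, h2, h3⟩ := ih hl h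
      exact ⟨b :: l', by simpa using ⟨hb, h1⟩, by simp [h2], by rw [hcons, hcons, h3, mul_assoc]⟩
    · have hab : reflProd l a = b := by
        by_contra hne
        have := (hD.refl_mem_posRoots hz hb ⟨hroot, h⟩ hne).2
        rw [hcons] at hneg
        exact lt_asymm this hneg
      refine ⟨l, hl, by simp, ?_⟩
      rw [hcons, ← hab, ← conj_refl _ (hD.subset ha).1.1]
      simp only [mul_assoc, inv_mul_cancel_left, refl_mul_refl, mul_one]

/-- A word in simple reflections that keeps the simple roots positive represents the identity: its
last letter is sent to a negative root by the rest of the word, so the word can be shortened. -/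
theorem reflProd_eq_one (hD : IsSimpleSystem W z D) (hz : ∀ a ∈ roots W, inner ℝ a z ≠ 0)
    (n : ℕ) : ∀ l : List V, l.length ≤ n → (∀ b ∈ l, b ∈ D) →
      (∀ a ∈ D, 0 < inner ℝ (reflProd l a) z) → reflProd l = 1 := by
  induction n with
  | zero =>
    intro l hl _ _
    rw [List.length_eq_zero_iff.1 (Nat.le_zero.1 hl)]
    rfl
  | succ n ih =>
    intro l hn hl hpos
    rcases List.eq_nil_or_concat l with rfl | ⟨l, a, rfl⟩
    · rfl
    · have happ : reflProd (l ++ [a]) = reflProd l * refl a := by simp [reflProd]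
      rw [List.concat_eq_append] at *
      have ha : a ∈ D := hl a (by simp)
      have h1 := hpos a ha
      rw [happ, LinearIsometryEquiv.coe_mul, Function.comp_apply, refl_self, map_neg,
        inner_neg_left] at h1
      obtain ⟨l', h2, h3, h4⟩ := hD.exists_delete hz ha l (fun b hb => hl b (by simp [hb]))
        (by linarith)
      rw [happ, ← h4] at hpos ⊢
      refine ih l' ?_ h2 hpos
      simp at hn
      omega

end IsSimpleSystem

/-- An element of `W` that fixes a vector on no reflecting hyperplane is the identity. -/
theorem eq_one_of_apply_eq_self [Finite W]
    (hW : Subgroup.closure {t | t ∈ W ∧ IsReflection t} = W) {z : V}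
    (hz : ∀ a ∈ roots W, inner ℝ a z ≠ 0) {w : V ≃ₗᵢ[ℝ] V} (hw : w ∈ W) (h : w z = z) :
    w = 1 := by
  obtain ⟨D, hD⟩ := exists_isSimpleSystem W z
  obtain ⟨l, hl, rfl⟩ := hD.exists_list hW hz hw
  refine hD.reflProd_eq_one hz _ l le_rfl hl fun a ha => ?_
  have : inner ℝ (reflProd l a) z = inner ℝ a z := by
    nth_rewrite 1 [← h]
    exact (reflProd l).inner_map_map a z
  rw [this]
  exact (hD.subset ha).2

theorem exists_regular (W : Subgroup (V ≃ₗᵢ[ℝ] V)) [Finite W] :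
    ∃ z : V, ∀ a ∈ roots W, inner ℝ a z ≠ 0 := by
  obtain ⟨z, -, hz⟩ := exists_mem_forall_inner_ne_zero (finite_roots W) ⊤ fun a ha =>
    ⟨a, trivial, by rw [real_inner_self_eq_norm_sq, ha.1]; norm_num⟩
  exact ⟨z, hz⟩

/-- Let `u ∈ W` fix the subspace `Y` pointwise. If `u` moves the regular vector `z` across none of
the reflecting hyperplanes containing `Y`, then `u = 1`: the sum of the orbit of `z` under the
powers of `u` is fixed by `u` and avoids those hyperplanes, `Y` avoids the others generically, so
the fixed space of `u` contains a regular vector. -/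
theorem eq_one_of_same_chamber [Finite W]
    (hW : Subgroup.closure {t | t ∈ W ∧ IsReflection t} = W) {z : V} {Y : Submodule ℝ V}
    {u : V ≃ₗᵢ[ℝ] V} (hu : u ∈ W) (huY : Y ≤ fix u)
    (h : ∀ a ∈ roots W, (∀ x ∈ Y, inner ℝ a x = 0) → 0 < inner ℝ a (u z) * inner ℝ a z) :
    u = 1 := by
  have hfin : IsOfFinOrder u :=
    MonoidHom.isOfFinOrder W.subtype (isOfFinOrder_of_finite (⟨u, hu⟩ : W))
  let p : V := ∑ i ∈ Finset.range (orderOf u), (u ^ i) z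
  have hpow : ∀ (i : ℕ) (x : V), (u ^ (i + 1)) x = u ((u ^ i) x) := fun i x => by
    rw [pow_succ']; rfl
  have hp : p ∈ fix u := by
    change u p = p
    rw [map_sum]
    simp_rw [← hpow]
    have h1 := Finset.sum_range_succ' (fun i => (u ^ i) z) (orderOf u)
    have h2 := Finset.sum_range_succ (fun i => (u ^ i) z) (orderOf u)
    rw [h1, pow_orderOf_eq_one, pow_zero] at h2
    exact add_right_cancel h2
  have hfixpow : ∀ (i : ℕ), ∀ x ∈ Y, (u ^ i) x = x := by
    intro i x hx
    induction i with
    | zero => rfl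
    | succ i ih => rw [hpow, ih]; exact huY hx
  -- the sign of a root vanishing on `Y` is constant on the orbit of `z`
  have hsign : ∀ a ∈ roots W, (∀ x ∈ Y, inner ℝ a x = 0) → 0 < inner ℝ a z →
      ∀ i : ℕ, 0 < inner ℝ a ((u ^ i) z) := by
    intro a ha haY hpos i
    induction i generalizing a with
    | zero => exact hpos
    | succ i ih =>
      have hmem : u⁻¹ a ∈ roots W := map_mem_roots (W.inv_mem hu) ha
      have hadj : ∀ x, inner ℝ a (u x) = inner ℝ (u⁻¹ a) x := fun x => by
        have h3 : u (u⁻¹ a) = a := u.apply_symm_apply a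
        rw [← u.inner_map_map (u⁻¹ a) x, h3]
      rw [hpow, hadj]
      refine ih _ hmem (fun x hx => ?_) ?_
      · rw [← hadj, show u x = x from huY hx]
        exact haY x hx
      · rw [← hadj]
        exact (pos_iff_pos_of_mul_pos (h a ha haY)).2 hpos
  have hp' : ∀ a ∈ roots W, (∀ x ∈ Y, inner ℝ a x = 0) → 0 < inner ℝ a z →
      0 < inner ℝ a p := by
    intro a ha haY hpos
    rw [inner_sum]
    exact Finset.sum_pos (fun i _ => hsign a ha haY hpos i)
      ⟨0, Finset.mem_range.2 hfin.orderOf_pos⟩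
  obtain ⟨z', hz', hreg⟩ := exists_mem_forall_inner_ne_zero (finite_roots W) (fix u) fun a ha => by
    by_cases haY : ∀ x ∈ Y, inner ℝ a x = 0
    · refine ⟨p, hp, ?_⟩
      have hne : inner ℝ a z ≠ 0 := right_ne_zero_of_mul (h a ha haY).ne'
      rcases hne.lt_or_gt with hlt | hlt
      · have := hp' (-a) (neg_mem_roots ha) (fun x hx => by rw [inner_neg_left, haY x hx, neg_zero])
          (by rw [inner_neg_left]; linarith)
        rw [inner_neg_left] at this
        linarith
      · exact (hp' a ha haY hlt).ne'
    · push Not at haY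
      obtain ⟨x, hx, hne⟩ := haY
      exact ⟨x, huY hx, hne⟩
  exact eq_one_of_apply_eq_self hW hreg hu hz'

/-- If `w` does not strictly maximize `v ↦ ⟨v z, z⟩` on the coset `w W_Y`, then some reflection
`t ∈ W_Y` increases its value at `w`. -/
theorem exists_refl_of_le [Finite W]
    (hW : Subgroup.closure {t | t ∈ W ∧ IsReflection t} = W) {z : V}
    (hz : ∀ a ∈ roots W, inner ℝ a z ≠ 0) {Y : Submodule ℝ V} {w u : V ≃ₗᵢ[ℝ] V} (hw : w ∈ W)
    (hu : u ∈ W) (huY : Y ≤ fix u) (hu1 : u ≠ 1)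
    (hle : inner ℝ (w z) z ≤ inner ℝ (w (u z)) z) :
    ∃ a ∈ roots W, (∀ x ∈ Y, inner ℝ a x = 0) ∧
      inner ℝ (w z) z < inner ℝ (w (refl a z)) z := by
  by_contra! hcon
  let q : V := w⁻¹ z
  have hq : ∀ x, inner ℝ (w x) z = inner ℝ x q := fun x => by
    rw [← w.inner_map_map x q, show w q = z from w.apply_symm_apply z]
  simp_rw [hq] at hle hcon
  have hqreg : ∀ a ∈ roots W, inner ℝ a q ≠ 0 := fun a ha => by
    rw [← hq]; exact hz _ (map_mem_roots hw ha)
  let S : Set (V ≃ₗᵢ[ℝ] V) := {v | v ∈ W ∧ Y ≤ fix v}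
  have hS : S.Finite := (Set.toFinite (W : Set (V ≃ₗᵢ[ℝ] V))).subset fun v hv => hv.1
  obtain ⟨v, ⟨hvW, hvY⟩, hmax⟩ := Set.exists_max_image S (fun v => inner ℝ (v z) q) hS
    ⟨u, hu, huY⟩
  have hrefl : ∀ (a : V) (_ : a ∈ roots W) (x : V), inner ℝ (refl a x) q =
      inner ℝ x q - 2 * (inner ℝ a x * inner ℝ a q) := fun a ha x => by
    rw [refl_apply ha.1, inner_sub_left, real_inner_smul_left]; ring
  -- a maximizer lies in the same chamber for the roots vanishing on `Y` as `q`, and so does `z`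
  have hone : ∀ v' ∈ S, inner ℝ (v z) q ≤ inner ℝ (v' z) q → v' = 1 := by
    rintro v' ⟨hv'W, hv'Y⟩ hge
    refine eq_one_of_same_chamber hW (z := z) hv'W hv'Y fun a ha haY => ?_
    have h1 : 0 < inner ℝ a z * inner ℝ a q := by
      have := hcon a ha haY
      rw [hrefl a ha] at this
      have h0 := mul_ne_zero (hz a ha) (hqreg a ha)
      exact lt_of_le_of_ne (by linarith) h0.symm
    have h2 : 0 < inner ℝ a (v' z) * inner ℝ a q := by
      have := hmax (refl a * v') ⟨W.mul_mem ha.2 hv'W, fun x hx => by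
        change refl a (v' x) = x
        rw [show v' x = x from hv'Y hx, refl_eq_self_iff ha.1]
        exact haY x hx⟩
      have h3 : inner ℝ (refl a (v' z)) q ≤ inner ℝ (v z) q := this
      rw [hrefl a ha] at h3
      have h4 : inner ℝ a (v' z) ≠ 0 := by
        have h5 : inner ℝ a (v' z) = inner ℝ (v'⁻¹ a) z := by
          rw [← v'.inner_map_map (v'⁻¹ a) z, show v' (v'⁻¹ a) = a from v'.apply_symm_apply a]
        rw [h5]
        exact hz _ (map_mem_roots (W.inv_mem hv'W) ha)
      have h0 := mul_ne_zero h4 (hqreg a ha)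
      exact lt_of_le_of_ne (by linarith) h0.symm
    have h6 := mul_pos h2 h1
    have h7 : 0 < inner ℝ a q ^ 2 := by have := hqreg a ha; positivity
    have h8 : inner ℝ a (v' z) * inner ℝ a q * (inner ℝ a z * inner ℝ a q) =
      (inner ℝ a (v' z) * inner ℝ a z) * inner ℝ a q ^ 2 := by ring
    rw [h8] at h6
    exact pos_of_mul_pos_left h6 h7.le
  have hv1 : v = 1 := hone v ⟨hvW, hvY⟩ le_rfl
  refine hu1 (hone u ⟨hu, huY⟩ ?_)
  rw [hv1]
  exact hle

end ReflectionGroup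

/-! ### Acyclicity of upper sets in an order complex -/

namespace OrderComplex

variable (R : Type*) [CommRing R] {P : Type*} [PartialOrder P]

/-- The chains of the order complex supported on simplices with all vertices in `U`. -/
def chainsIn (U : Set P) (k : ℕ) : Submodule R (Chains R P k) :=
  Finsupp.supported R R {c | ∀ i, c i ∈ U}

variable {R}

theorem single_mem_chainsIn {U : Set P} {k : ℕ} {c : Simplex P k} (hc : ∀ i, c i ∈ U) (r : R) :
    Finsupp.single c r ∈ chainsIn R U k :=
  Finsupp.single_mem_supported R r hc

theorem chainsIn_induction {U : Set P} {k : ℕ} {p : Chains R P k → Prop} (h0 : p 0)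
    (hadd : ∀ x y, p x → p y → p (x + y))
    (hs : ∀ (c : Simplex P k) (r : R), (∀ i, c i ∈ U) → p (Finsupp.single c r))
    {x : Chains R P k} (hx : x ∈ chainsIn R U k) : p x := by
  classical
  rw [← Finsupp.sum_single x, Finsupp.sum]
  exact Finset.sum_induction _ p hadd h0 fun c hc => hs c _ (hx hc)

theorem boundary_mem_chainsIn {U : Set P} {k : ℕ} {x : Chains R P (k + 1)}
    (hx : x ∈ chainsIn R U (k + 1)) : boundary R P k x ∈ chainsIn R U k := by
  refine chainsIn_induction (p := fun x => boundary R P k x ∈ chainsIn R U k)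
    (by rw [map_zero]; exact zero_mem _)
    (fun x y hx hy => by rw [map_add]; exact add_mem hx hy) (fun c r hc => ?_) hx
  · rw [boundary_single]
    exact sum_mem fun i _ => Submodule.smul_mem _ _
      (single_mem_chainsIn (c := face i c) (fun j => hc (i.succAbove j)) r)

theorem chainsIn_inter (U₁ U₂ : Set P) (k : ℕ) :
    chainsIn R (U₁ ∩ U₂) k = chainsIn R U₁ k ⊓ chainsIn R U₂ k := by
  rw [chainsIn, chainsIn, chainsIn, ← Finsupp.supported_inter]
  congr 1
  ext c
  exact forall_and

theorem chainsIn_mono {U₁ U₂ : Set P} (h : U₁ ⊆ U₂) (k : ℕ) :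
    chainsIn R U₁ k ≤ chainsIn R U₂ k :=
  Finsupp.supported_mono fun _ hc i => h (hc i)

/-- A nonempty chain in a union of two upper sets lies in that upper set which contains its least
element. -/
theorem chainsIn_union {U₁ U₂ : Set P} (h₁ : IsUpperSet U₁) (h₂ : IsUpperSet U₂) (k : ℕ) :
    chainsIn R (U₁ ∪ U₂) (k + 1) = chainsIn R U₁ (k + 1) ⊔ chainsIn R U₂ (k + 1) := by
  rw [chainsIn, chainsIn, chainsIn, ← Finsupp.supported_union]
  congr 1
  ext c
  constructor
  · intro hc
    exact (hc 0).imp (fun h i => h₁ (c.monotone (Fin.zero_le i)) h)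
      (fun h i => h₂ (c.monotone (Fin.zero_le i)) h)
  · rintro (h | h) i
    · exact Or.inl (h i)
    · exact Or.inr (h i)

theorem mem_cycles_succ {k : ℕ} {x : Chains R P (k + 1)} :
    x ∈ cycles R P (k + 1) ↔ boundary R P k x = 0 := Iff.rfl

variable (R) in
/-- The reduced homology of the order complex of `U` vanishes in degree `k - 1`: every cycle
supported on `U` is the boundary of a chain supported on `U`. -/
def AcyclicOn (U : Set P) (k : ℕ) : Prop :=
  ∀ z ∈ cycles R P k, z ∈ chainsIn R U k → ∃ y ∈ chainsIn R U (k + 1), boundary R P k y = z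

instance : Unique (Simplex P 0) where
  default := OrderEmbedding.ofStrictMono Fin.elim0 fun i => i.elim0
  uniq _ := DFunLike.ext _ _ fun i => i.elim0

theorem acyclicOn_zero {U : Set P} (hU : U.Nonempty) : AcyclicOn R U 0 := by
  obtain ⟨a, ha⟩ := hU
  intro z _ _
  let c : Simplex P 1 := OrderEmbedding.ofStrictMono (fun _ => a)
    fun i j h => absurd h (by simp [Subsingleton.elim i j])
  refine ⟨Finsupp.single c (z default), single_mem_chainsIn (fun _ => ha) _, ?_⟩
  rw [boundary_single]
  ext
  simp [Subsingleton.elim (face 0 c) default]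

/-- The Mayer–Vietoris step for two upper sets. -/
theorem AcyclicOn.union {U₁ U₂ : Set P} (h₁ : IsUpperSet U₁) (h₂ : IsUpperSet U₂) {k : ℕ}
    (a₁ : AcyclicOn R U₁ (k + 1)) (a₂ : AcyclicOn R U₂ (k + 1)) (a₁₂ : AcyclicOn R (U₁ ∩ U₂) k) :
    AcyclicOn R (U₁ ∪ U₂) (k + 1) := by
  intro z hz hzU
  rw [chainsIn_union h₁ h₂, Submodule.mem_sup] at hzU
  obtain ⟨z₁, hz₁, z₂, hz₂, rfl⟩ := hzU
  rw [mem_cycles_succ, map_add] at hz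
  obtain ⟨y, hy, hyz⟩ := a₁₂ (boundary R P k z₁)
    (boundaries_le_cycles R P k (LinearMap.mem_range_self _ _)) (by
      rw [chainsIn_inter]
      refine ⟨boundary_mem_chainsIn hz₁, ?_⟩
      rw [eq_neg_of_add_eq_zero_left hz]
      exact neg_mem (boundary_mem_chainsIn hz₂))
  rw [chainsIn_inter] at hy
  obtain ⟨x₁, hx₁, h₁'⟩ := a₁ (z₁ - y) (by rw [mem_cycles_succ, map_sub, hyz, sub_self])
    (sub_mem hz₁ hy.1)
  obtain ⟨x₂, hx₂, h₂'⟩ := a₂ (z₂ + y)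
    (by rw [mem_cycles_succ, map_add, hyz, add_comm, hz]) (add_mem hz₂ hy.2)
  refine ⟨x₁ + x₂, add_mem (chainsIn_mono Set.subset_union_left _ hx₁)
    (chainsIn_mono Set.subset_union_right _ hx₂), ?_⟩
  rw [map_add, h₁', h₂']
  abel

/-- The simplex obtained by adjoining a new least vertex. -/
def cons {k : ℕ} (a : P) (c : Simplex P k) (h : ∀ i, a < c i) : Simplex P (k + 1) :=
  OrderEmbedding.ofStrictMono (Fin.cons a c) fun i j hij => by
    induction j using Fin.cases with
    | zero => exact absurd hij (Fin.not_lt_zero i)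
    | succ j =>
      induction i using Fin.cases with
      | zero => simpa using h j
      | succ i => simpa using hij

@[simp]
theorem cons_succ {k : ℕ} (a : P) (c : Simplex P k) (h : ∀ i, a < c i) (i : Fin k) :
    cons a c h i.succ = c i := rfl

theorem face_apply {k : ℕ} (i : Fin (k + 1)) (c : Simplex P (k + 1)) (j : Fin k) :
    face i c j = c (i.succAbove j) := rfl

theorem face_zero_cons {k : ℕ} (a : P) (c : Simplex P k) (h : ∀ i, a < c i) :
    face 0 (cons a c h) = c := by
  ext i
  rw [face_apply, Fin.zero_succAbove, cons_succ]

theorem lt_face {k : ℕ} {a : P} {c : Simplex P (k + 1)} (h : ∀ i, a < c i) (i : Fin (k + 1)) :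
    ∀ j, a < face i c j := fun j => h (i.succAbove j)

theorem face_succ_cons {k : ℕ} (a : P) (c : Simplex P (k + 1)) (h : ∀ i, a < c i)
    (i : Fin (k + 1)) : face i.succ (cons a c h) = cons a (face i c) (lt_face h i) := by
  ext j
  induction j using Fin.cases with
  | zero => rw [face_apply, Fin.succ_succAbove_zero]; rfl
  | succ j => rw [face_apply, Fin.succ_succAbove_succ]; rfl

theorem lt_face_zero {k : ℕ} (c : Simplex P (k + 1)) (i : Fin k) : c 0 < face 0 c i := by
  rw [face_apply, Fin.zero_succAbove]
  exact c.strictMono (Fin.succ_pos i)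

theorem cons_face_zero {k : ℕ} (c : Simplex P (k + 1)) :
    cons (c 0) (face 0 c) (lt_face_zero c) = c := by
  ext i
  induction i using Fin.cases with
  | zero => rfl
  | succ i => rw [cons_succ, face_apply, Fin.zero_succAbove]

open scoped Classical in
variable (R) in
/-- The cone operator with apex `a`, adjoining `a` to the simplices above it. -/
noncomputable def coneMap (a : P) (k : ℕ) : Chains R P k →ₗ[R] Chains R P (k + 1) :=
  Finsupp.lsum R fun c => if h : ∀ i, a < c i then Finsupp.lsingle (cons a c h) else 0

theorem coneMap_single_of_lt {a : P} {k : ℕ} (c : Simplex P k) (h : ∀ i, a < c i) (r : R) :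
    coneMap R a k (Finsupp.single c r) = Finsupp.single (cons a c h) r := by
  simp [coneMap, h]

theorem coneMap_single_of_not {a : P} {k : ℕ} (c : Simplex P k) (h : ¬ ∀ i, a < c i) (r : R) :
    coneMap R a k (Finsupp.single c r) = 0 := by
  simp [coneMap, h]

theorem coneMap_mem_chainsIn {U : Set P} {a : P} (ha : a ∈ U) {k : ℕ} {x : Chains R P k}
    (hx : x ∈ chainsIn R U k) : coneMap R a k x ∈ chainsIn R U (k + 1) := by
  refine chainsIn_induction (p := fun x => coneMap R a k x ∈ chainsIn R U (k + 1))
    (by rw [map_zero]; exact zero_mem _)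
    (fun x y hx hy => by rw [map_add]; exact add_mem hx hy) (fun c r hc => ?_) hx
  · by_cases h : ∀ i, a < c i
    · rw [coneMap_single_of_lt c h]
      refine single_mem_chainsIn (fun i => ?_) r
      induction i using Fin.cases with
      | zero => exact ha
      | succ i => exact hc i
    · rw [coneMap_single_of_not c h]
      exact zero_mem _

/-- On a set with least element `a`, the cone operator is a contracting homotopy. -/
theorem boundary_coneMap {U : Set P} {a : P} (ha : ∀ x ∈ U, a ≤ x) {k : ℕ}
    {x : Chains R P (k + 1)} (hx : x ∈ chainsIn R U (k + 1)) :
    boundary R P (k + 1) (coneMap R a (k + 1) x) + coneMap R a k (boundary R P k x) = x := by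
  refine chainsIn_induction (p := fun x => boundary R P (k + 1) (coneMap R a (k + 1) x) +
    coneMap R a k (boundary R P k x) = x) (by simp) (fun x y hx hy => ?_) (fun c r hc => ?_) hx
  · simp only [map_add]
    rw [add_add_add_comm, hx, hy]
  · rw [boundary_single, map_sum]
    simp only [map_smul]
    rcases (ha _ (hc 0)).eq_or_lt with h | h
    · rw [coneMap_single_of_not c fun h' => (h' 0).ne h, map_zero, zero_add, Fin.sum_univ_succ,
        Finset.sum_eq_zero, add_zero]
      · subst h
        rw [coneMap_single_of_lt _ (lt_face_zero c), cons_face_zero]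
        simp
      · intro i _
        rw [coneMap_single_of_not, smul_zero]
        obtain ⟨k, rfl⟩ : ∃ k', k = k' + 1 := Nat.exists_eq_succ_of_ne_zero (by
          rintro rfl; exact i.elim0)
        intro h'
        have := h' 0
        rw [face_apply, Fin.succ_succAbove_zero] at this
        exact this.ne h
    · have hlt : ∀ i, a < c i := fun i => h.trans_le (c.monotone (Fin.zero_le i))
      rw [coneMap_single_of_lt c hlt, boundary_single, Fin.sum_univ_succ, face_zero_cons,
        add_assoc, ← Finset.sum_add_distrib, Finset.sum_eq_zero]
      · simp
      · intro i _
        rw [face_succ_cons, coneMap_single_of_lt _ (lt_face hlt i), ← add_smul, Fin.val_succ,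
          pow_succ]
        simp

/-- A set with a least element is acyclic. -/
theorem acyclicOn_of_isLeast {U : Set P} {a : P} (ha : IsLeast U a) (k : ℕ) :
    AcyclicOn R U k := by
  cases k with
  | zero => exact acyclicOn_zero ⟨a, ha.1⟩
  | succ k =>
    intro z hz hzU
    refine ⟨coneMap R a (k + 1) z, coneMap_mem_chainsIn ha.1 hzU, ?_⟩
    have := boundary_coneMap (fun x hx => ha.2 hx) hzU
    rwa [mem_cycles_succ.1 hz, map_zero, add_zero] at this

theorem isUpperSet_setOf_exists_le (T : Set P) : IsUpperSet {y | ∃ a ∈ T, a ≤ y} :=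
  fun _ _ hxy ⟨a, ha, hax⟩ => ⟨a, ha, hax.trans hxy⟩

/-- In a poset with corank function `d` in which any two covers of an element have a join covering
both (the local condition satisfied by geometric lattices), the upper set generated by a nonempty
set of covers of `c` has no reduced homology below degree `d c - 2`. The covers are added one at a
time; the cone over a new cover `a` meets the earlier ones in an upper set of the same kind,
generated by covers of `a`. -/
theorem acyclicOn_covers [Finite P] (d : P → ℕ)
    (hd : ∀ c a b : P, c ≤ a → c ≤ b → d a + 1 = d c → d b + 1 = d c → a ≠ b → 3 ≤ d c →
      ∃ j, a ≤ j ∧ b ≤ j ∧ d j + 1 = d a ∧ ∀ y, a ≤ y → b ≤ y → j ≤ y)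
    (k : ℕ) : ∀ (c : P) (T : Set P), T.Nonempty → (∀ a ∈ T, c ≤ a ∧ d a + 1 = d c) →
      k + 1 < d c → AcyclicOn R {y | ∃ a ∈ T, a ≤ y} k := by
  induction k with
  | zero =>
    rintro c T ⟨a, ha⟩ _ _
    exact acyclicOn_zero ⟨a, a, ha, le_rfl⟩
  | succ k ih =>
    intro c T hne hT hk
    induction T, Set.toFinite T using Set.Finite.induction_on with
    | empty => exact absurd hne Set.not_nonempty_empty
    | @insert a s has _ ihs =>
      have hcone : AcyclicOn R (Set.Ici a) (k + 1) :=
        acyclicOn_of_isLeast isLeast_Ici _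
      have hset : {y | ∃ b ∈ insert a s, b ≤ y} = Set.Ici a ∪ {y | ∃ b ∈ s, b ≤ y} := by
        ext y
        simp
      rw [hset]
      rcases s.eq_empty_or_nonempty with rfl | hs
      · simpa using hcone
      have haT := hT a (Set.mem_insert _ _)
      let T' : Set P := {j | a ≤ j ∧ d j + 1 = d a ∧ ∃ b ∈ s, b ≤ j}
      have hjoin : ∀ b ∈ s, ∃ j ∈ T', ∀ y, a ≤ y → b ≤ y → j ≤ y := by
        intro b hb
        have hbT := hT b (Set.mem_insert_of_mem _ hb)
        obtain ⟨j, h1, h2, h3, h4⟩ := hd c a b haT.1 hbT.1 haT.2 hbT.2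
          (by rintro rfl; exact has hb) (by omega)
        exact ⟨j, ⟨h1, h3, b, hb, h2⟩, h4⟩
      refine AcyclicOn.union (isUpperSet_Ici _) (isUpperSet_setOf_exists_le _)
        hcone (ihs hs fun b hb => hT b (Set.mem_insert_of_mem _ hb)) ?_
      have hinter : Set.Ici a ∩ {y | ∃ b ∈ s, b ≤ y} = {y | ∃ j ∈ T', j ≤ y} := by
        ext y
        constructor
        · rintro ⟨hay, b, hb, hby⟩
          obtain ⟨j, hj, h⟩ := hjoin b hb
          exact ⟨j, hj, h y hay hby⟩
        · rintro ⟨j, ⟨h1, -, b, hb, h2⟩, hjy⟩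
          exact ⟨h1.trans hjy, b, hb, h2.trans hjy⟩
      rw [hinter]
      refine ih a T' ?_ (fun j hj => ⟨hj.1, hj.2.1⟩) (by omega)
      obtain ⟨b, hb⟩ := hs
      obtain ⟨j, hj, -⟩ := hjoin b hb
      exact ⟨j, hj⟩

/-- Let the poset be covered by the cones over elements `m i` of corank `n`. Suppose that the
indices carry a height `f` such that, whenever the cone over `m i` meets the cone over a different
`m j` of at least the same height in a point `x`, there is a cover of `m i` below `x` that lies in
a cone of strictly larger height; for `n ≥ 2`, such a cover is also required when the two cones are
disjoint, so that each cone but the first is attached along a nonempty set. Adding the cones by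
decreasing height then shows that the reduced homology vanishes below degree `n - 1`. -/
theorem acyclicOn_univ_of_height [Finite P] (d : P → ℕ)
    (hd : ∀ c a b : P, c ≤ a → c ≤ b → d a + 1 = d c → d b + 1 = d c → a ≠ b → 3 ≤ d c →
      ∃ j, a ≤ j ∧ b ≤ j ∧ d j + 1 = d a ∧ ∀ y, a ≤ y → b ≤ y → j ≤ y)
    {ι : Type*} [Finite ι] [Nonempty ι] (m : ι → P) (f : ι → ℝ) (n : ℕ)
    (hm : ∀ i, d (m i) = n) (hcover : ∀ x, ∃ i, m i ≤ x)
    (hne : 2 ≤ n → ∀ i j, i ≠ j → f i ≤ f j →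
      ∃ a, m i ≤ a ∧ d a + 1 = n ∧ ∃ j', f i < f j' ∧ m j' ≤ a)
    (hex : ∀ i j x, i ≠ j → f i ≤ f j → m i ≤ x → m j ≤ x →
      ∃ a, m i ≤ a ∧ a ≤ x ∧ d a + 1 = n ∧ ∃ j', f i < f j' ∧ m j' ≤ a)
    {k : ℕ} (hk : k < n) : AcyclicOn R (Set.univ : Set P) k := by
  classical
  cases k with
  | zero => exact acyclicOn_zero ⟨m (Classical.arbitrary ι), trivial⟩
  | succ k =>
  have := Fintype.ofFinite ι
  suffices h : ∀ S : Finset ι, S.Nonempty → (∀ i j, j ∈ S → f j < f i → i ∈ S) →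
      AcyclicOn R {y | ∃ i ∈ S, m i ≤ y} (k + 1) by
    have h' := h Finset.univ Finset.univ_nonempty fun _ _ _ _ => Finset.mem_univ _
    have hset : {y | ∃ i ∈ (Finset.univ : Finset ι), m i ≤ y} = Set.univ := by
      ext y
      simpa using hcover y
    rwa [hset] at h'
  intro S
  induction S using Finset.strongInduction with
  | H S ih =>
  intro hS hup
  obtain ⟨i, hi, hmin⟩ := S.exists_min_image f hS
  have hcone : AcyclicOn R (Set.Ici (m i)) (k + 1) :=
    acyclicOn_of_isLeast isLeast_Ici _
  have hset : {y | ∃ j ∈ S, m j ≤ y} = Set.Ici (m i) ∪ {y | ∃ j ∈ S.erase i, m j ≤ y} := by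
    ext y
    nth_rewrite 1 [← Finset.insert_erase hi]
    simp only [Finset.mem_insert, exists_eq_or_imp]
    rfl
  rw [hset]
  rcases (S.erase i).eq_empty_or_nonempty with h0 | h0
  · rw [h0]
    simpa using hcone
  refine AcyclicOn.union (isUpperSet_Ici _)
    (fun x y hxy h => h.imp fun j hj => ⟨hj.1, hj.2.trans hxy⟩) hcone
    (ih _ (Finset.erase_ssubset hi) h0 fun i' j hj hlt => ?_) ?_
  · refine Finset.mem_erase.2 ⟨?_, hup i' j (Finset.mem_of_mem_erase hj) hlt⟩
    rintro rfl
    exact not_le.2 hlt (hmin j (Finset.mem_of_mem_erase hj))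
  let T : Set P := {a | m i ≤ a ∧ d a + 1 = n ∧ ∃ j', f i < f j' ∧ m j' ≤ a}
  have hinter : Set.Ici (m i) ∩ {y | ∃ j ∈ S.erase i, m j ≤ y} = {y | ∃ a ∈ T, a ≤ y} := by
    ext y
    constructor
    · rintro ⟨h1, j, hj, h2⟩
      obtain ⟨hji, hj⟩ := Finset.mem_erase.1 hj
      obtain ⟨a, ha1, ha2, ha3⟩ := hex i j y hji.symm (hmin j hj) h1 h2
      exact ⟨a, ⟨ha1, ha3⟩, ha2⟩
    · rintro ⟨a, ⟨h1, h2, j, h3, h4⟩, hay⟩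
      refine ⟨h1.trans hay, j, Finset.mem_erase.2 ⟨?_, hup j i hi h3⟩, h4.trans hay⟩
      rintro rfl
      exact lt_irrefl _ h3
  rw [hinter]
  refine acyclicOn_covers d hd k (m i) T ?_ (fun a ha => ⟨ha.1, by rw [hm]; exact ha.2.1⟩)
    (by rw [hm]; exact hk)
  obtain ⟨j, hj⟩ := h0
  obtain ⟨hji, hj⟩ := Finset.mem_erase.1 hj
  exact hne (by omega) i j hji.symm (hmin j hj)

end OrderComplex

/-! ### The poset of parabolic cosets and the vanishing of its homology -/

namespace ReflectionGroup

variable {V : Type*} [NormedAddCommGroup V] [InnerProductSpace ℝ V]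
  {W : Subgroup (V ≃ₗᵢ[ℝ] V)}

namespace IntersectionLattice

theorem mem_parabolic {X : IntersectionLattice W} {w : W} :
    w ∈ X.parabolic ↔ X.space ≤ fix (w : V ≃ₗᵢ[ℝ] V) := Iff.rfl

/-- The fixed space of the parabolic subgroup `W_X` is `X` itself. -/
theorem mem_space_iff {X : IntersectionLattice W} {v : V} :
    v ∈ X.space ↔ ∀ w ∈ X.parabolic, (w : V ≃ₗᵢ[ℝ] V) v = v := by
  refine ⟨fun hv w hw => hw hv, fun h => ?_⟩
  obtain ⟨S, hS, hX⟩ := X.exists_eq_sInf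
  rw [hX, Submodule.mem_sInf]
  intro H hH
  obtain ⟨t, ht, -, rfl⟩ := hS hH
  refine h ⟨t, ht⟩ (mem_parabolic.2 ?_)
  rw [hX]
  exact sInf_le hH

theorem parabolic_le_iff {X Y : IntersectionLattice W} : X.parabolic ≤ Y.parabolic ↔ X ≤ Y := by
  refine ⟨fun h v hv => mem_space_iff.2 fun w hw => h hw hv, fun h w hw v hv => hw (h hv)⟩

theorem parabolic_injective : Function.Injective (parabolic : IntersectionLattice W → _) :=
  fun _ _ h => le_antisymm (parabolic_le_iff.1 h.le) (parabolic_le_iff.1 h.ge)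

/-- The whole space, as an element of the intersection lattice. -/
def whole (W : Subgroup (V ≃ₗᵢ[ℝ] V)) : IntersectionLattice W where
  space := ⊤
  exists_eq_sInf := ⟨∅, Set.empty_subset _, sInf_empty.symm⟩

/-- The intersection of two elements of the intersection lattice. -/
def inter (X Y : IntersectionLattice W) : IntersectionLattice W where
  space := X.space ⊓ Y.space
  exists_eq_sInf := by
    obtain ⟨S, hS, hX⟩ := X.exists_eq_sInf
    obtain ⟨T, hT, hY⟩ := Y.exists_eq_sInf
    exact ⟨S ∪ T, Set.union_subset hS hT, by rw [sInf_union, hX, hY]⟩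

/-- The reflecting hyperplane orthogonal to a root. -/
noncomputable def ofRoot (a : V) (ha : a ∈ roots W) : IntersectionLattice W where
  space := fix (refl a)
  exists_eq_sInf := ⟨{fix (refl a)}, Set.singleton_subset_iff.2
    ⟨refl a, ha.2, isReflection_refl ha.1, rfl⟩, sInf_singleton.symm⟩

theorem mem_space_ofRoot {a : V} (ha : a ∈ roots W) {x : V} :
    x ∈ (ofRoot a ha).space ↔ inner ℝ a x = 0 := refl_eq_self_iff ha.1 x

theorem finrank_space_ofRoot [FiniteDimensional ℝ V] {a : V} (ha : a ∈ roots W) :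
    Module.finrank ℝ (ofRoot a ha).space + 1 = Module.finrank ℝ V := by
  have h : (ofRoot a ha).space = (ℝ ∙ a)ᗮ := by
    ext x
    rw [mem_space_ofRoot, Submodule.mem_orthogonal_singleton_iff_inner_right]
  have ha0 : a ≠ 0 := by rintro rfl; simpa using ha.1
  have h2 := (ℝ ∙ a).finrank_add_finrank_orthogonal
  rw [finrank_span_singleton ha0] at h2
  rw [h]
  omega

theorem parabolic_eq_top_iff (hW : IsEssentialReflectionGroup W) {X : IntersectionLattice W} :
    X.parabolic = ⊤ ↔ X.space = ⊥ := by
  constructor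
  · intro h
    refine eq_bot_iff.2 fun v hv => (Submodule.mem_bot ℝ).2 (hW.essential v fun w hw => ?_)
    exact mem_space_iff.1 hv ⟨w, hw⟩ (h ▸ Subgroup.mem_top _)
  · intro h
    refine eq_top_iff.2 fun w _ => mem_parabolic.2 ?_
    rw [h]
    exact bot_le

end IntersectionLattice

open IntersectionLattice

theorem mem_smul_parabolic {u w : W} {X : IntersectionLattice W} :
    u ∈ w • (X.parabolic : Set W) ↔ w⁻¹ * u ∈ X.parabolic := by
  rw [Set.mem_smul_set_iff_inv_smul_mem]
  rfl

theorem smul_parabolic_eq_of_mem {u w : W} {X : IntersectionLattice W}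
    (h : u ∈ w • (X.parabolic : Set W)) :
    w • (X.parabolic : Set W) = u • (X.parabolic : Set W) :=
  (leftCoset_eq_iff X.parabolic).2 (mem_smul_parabolic.1 h)

theorem smul_parabolic_eq_univ_iff (hW : IsEssentialReflectionGroup W) {w : W}
    {X : IntersectionLattice W} : w • (X.parabolic : Set W) = Set.univ ↔ X.space = ⊥ := by
  rw [← parabolic_eq_top_iff hW, ← Subgroup.coe_eq_univ]
  constructor
  · intro h
    rw [← inv_smul_smul w (X.parabolic : Set W), h, Set.smul_set_univ]
  · intro h
    rw [h, Set.smul_set_univ]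

namespace ProperPart

/-- The element of the intersection lattice to which a coset of a parabolic subgroup belongs. -/
noncomputable def type (C : ProperPart W) : IntersectionLattice W :=
  C.1.2.choose_spec.choose

theorem eq_smul_of_mem {C : ProperPart W} {w : W} (hw : w ∈ C.1.1) :
    C.1.1 = w • (C.type.parabolic : Set W) := by
  have h := C.1.2.choose_spec.choose_spec
  rw [h] at hw
  rw [h]
  exact smul_parabolic_eq_of_mem hw

theorem exists_mem (C : ProperPart W) : ∃ w, w ∈ C.1.1 := by
  obtain ⟨w, X, h⟩ := C.1.2
  exact ⟨w, by rw [h, mem_smul_parabolic, inv_mul_cancel]; exact one_mem _⟩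

/-- The coset `w W_X`, for `X ≠ 0`. -/
def mk (hW : IsEssentialReflectionGroup W) (w : W) (X : IntersectionLattice W)
    (hX : X.space ≠ ⊥) : ProperPart W :=
  ⟨⟨w • (X.parabolic : Set W), w, X, rfl⟩, fun h => hX ((smul_parabolic_eq_univ_iff hW).1 h)⟩

variable {hW : IsEssentialReflectionGroup W}

theorem mem_mk {u w : W} {X : IntersectionLattice W} {hX : X.space ≠ ⊥} :
    u ∈ (mk hW w X hX).1.1 ↔ w⁻¹ * u ∈ X.parabolic := mem_smul_parabolic

theorem self_mem_mk (w : W) (X : IntersectionLattice W) (hX : X.space ≠ ⊥) :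
    w ∈ (mk hW w X hX).1.1 := by
  rw [mem_mk, inv_mul_cancel]
  exact one_mem _

@[simp]
theorem type_mk (w : W) (X : IntersectionLattice W) (hX : X.space ≠ ⊥) :
    (mk hW w X hX).type = X := by
  have h : w • (X.parabolic : Set W) = w • ((mk hW w X hX).type.parabolic : Set W) :=
    eq_smul_of_mem (self_mem_mk w X hX)
  exact parabolic_injective (SetLike.coe_injective (smul_left_cancel w h)).symm

theorem type_space_ne_bot (hW : IsEssentialReflectionGroup W) (C : ProperPart W) :
    C.type.space ≠ ⊥ := by
  obtain ⟨w, hw⟩ := C.exists_mem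
  intro h
  exact C.2 ((eq_smul_of_mem hw).trans ((smul_parabolic_eq_univ_iff hW).2 h))

theorem eq_mk_of_mem (hW : IsEssentialReflectionGroup W) {C : ProperPart W} {w : W}
    (hw : w ∈ C.1.1) : C = mk hW w C.type (C.type_space_ne_bot hW) :=
  Subtype.ext (Subtype.ext (eq_smul_of_mem hw))

/-- Parabolic cosets with a common element are ordered as their types are. -/
theorem le_iff_of_mem {C D : ProperPart W} {w : W} (hC : w ∈ C.1.1) (hD : w ∈ D.1.1) :
    C ≤ D ↔ C.type ≤ D.type := by
  change C.1.1 ⊆ D.1.1 ↔ _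
  rw [eq_smul_of_mem hC, eq_smul_of_mem hD, Set.smul_set_subset_smul_set_iff]
  exact parabolic_le_iff

theorem mk_whole_le_iff {w : W} {h : (whole W).space ≠ ⊥} {C : ProperPart W} :
    mk hW w (whole W) h ≤ C ↔ w ∈ C.1.1 := by
  refine ⟨fun hle => hle (self_mem_mk w _ h), fun hw => ?_⟩
  rw [le_iff_of_mem (self_mem_mk _ _ _) hw, type_mk]
  exact le_top (a := C.type.space)

theorem type_mono : Monotone (type : ProperPart W → IntersectionLattice W) := fun C _ h =>
  let ⟨_, hw⟩ := C.exists_mem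
  (le_iff_of_mem hw (h hw)).1 h

theorem eq_of_le_of_type_eq {C D : ProperPart W} (h : C ≤ D) (ht : C.type = D.type) : C = D := by
  obtain ⟨w, hw⟩ := C.exists_mem
  refine Subtype.ext (Subtype.ext ?_)
  rw [eq_smul_of_mem hw, eq_smul_of_mem (h hw), ht]

theorem type_strictMono : StrictMono (type : ProperPart W → IntersectionLattice W) :=
  fun _ _ h => (type_mono h.le).lt_of_ne fun ht => h.ne (eq_of_le_of_type_eq h.le ht)

/-- The dimension of the subspace to which a coset belongs. -/
noncomputable def dim (C : ProperPart W) : ℕ := Module.finrank ℝ C.type.space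

variable [FiniteDimensional ℝ V]

theorem dim_strictAnti : StrictAnti (dim : ProperPart W → ℕ) := fun _ _ h =>
  Submodule.finrank_lt_finrank_of_lt (lt_iff_le_not_ge.2 (lt_iff_le_not_ge.1 (type_strictMono h)))

theorem dim_pos (hW : IsEssentialReflectionGroup W) (C : ProperPart W) : 0 < C.dim :=
  Nat.pos_of_ne_zero fun h => C.type_space_ne_bot hW (Submodule.finrank_eq_zero.1 h)

theorem dim_le (C : ProperPart W) : C.dim ≤ Module.finrank ℝ V := Submodule.finrank_le _

instance [Finite W] : Finite (ProperPart W) :=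
  Subtype.finite

/-- Chains of proper parabolic cosets have at most `dim V` elements. -/
theorem isEmpty_simplex (hW : IsEssentialReflectionGroup W) {k : ℕ}
    (hk : Module.finrank ℝ V < k) : IsEmpty (OrderComplex.Simplex (ProperPart W) k) := by
  refine ⟨fun c => ?_⟩
  have hinj : Function.Injective fun i => (c i).dim :=
    (dim_strictAnti.comp_strictMono c.strictMono).injective
  have := Finset.card_le_card_of_injOn (s := Finset.univ)
    (t := Finset.Icc 1 (Module.finrank ℝ V)) _
    (fun i _ => Finset.mem_coe.2 (Finset.mem_Icc.2 ⟨(c i).dim_pos hW, (c i).dim_le⟩)) hinj.injOn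
  simp at this
  omega

/-- Two distinct subspaces of codimension one in a third meet in codimension two; so two covers of
a parabolic coset have a join, which covers both. -/
theorem exists_join (hW : IsEssentialReflectionGroup W) (C A B : ProperPart W) (hCA : C ≤ A)
    (hCB : C ≤ B) (hA : A.dim + 1 = C.dim) (hB : B.dim + 1 = C.dim) (hAB : A ≠ B)
    (hC : 3 ≤ C.dim) :
    ∃ J, A ≤ J ∧ B ≤ J ∧ J.dim + 1 = A.dim ∧ ∀ Y, A ≤ Y → B ≤ Y → J ≤ Y := by
  obtain ⟨w, hw⟩ := C.exists_mem
  have hwA := hCA hw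
  have hwB := hCB hw
  have hdim : Module.finrank ℝ (A.type.inter B.type).space + 1 = A.dim := by
    have h1 := Submodule.finrank_sup_add_finrank_inf_eq A.type.space B.type.space
    have h2 : A.type.space ⊔ B.type.space ≤ C.type.space :=
      sup_le (type_mono hCA) (type_mono hCB)
    have h3 := Submodule.finrank_mono h2
    have h4 : A.type.space < A.type.space ⊔ B.type.space := by
      refine lt_of_le_of_ne le_sup_left fun h => hAB ?_
      have h5 : B.type.space ≤ A.type.space := by rw [h]; exact le_sup_right
      have h6 : B.type.space = A.type.space :=
        Submodule.eq_of_le_of_finrank_eq h5 (by change B.dim = A.dim; omega)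
      rw [eq_mk_of_mem hW hwA, eq_mk_of_mem hW hwB]
      congr 1
      exact space_injective h6.symm
    have h7 := Submodule.finrank_lt_finrank_of_lt h4
    change Module.finrank ℝ (A.type.space ⊓ B.type.space : Submodule ℝ V) + 1 = _
    simp only [dim] at *
    omega
  have hne : (A.type.inter B.type).space ≠ ⊥ := by
    intro h
    rw [h, finrank_bot] at hdim
    omega
  refine ⟨mk hW w _ hne, ?_, ?_, ?_, ?_⟩
  · rw [le_iff_of_mem hwA (self_mem_mk _ _ _), type_mk]
    exact inf_le_left (a := A.type.space)
  · rw [le_iff_of_mem hwB (self_mem_mk _ _ _), type_mk]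
    exact inf_le_right (a := A.type.space)
  · rw [dim, type_mk, hdim]
  · intro Y hAY hBY
    rw [le_iff_of_mem (self_mem_mk _ _ _) (hAY hwA), type_mk]
    have h1 : Y.type.space ≤ A.type.space := type_mono hAY
    have h2 : Y.type.space ≤ B.type.space := type_mono hBY
    exact le_inf h1 h2

/-- The reduced homology of the proper part of the poset of parabolic cosets vanishes below the top
degree. The elements of `W`, which are the minimal cosets, are taken in decreasing order of
`w ↦ ⟨w z, z⟩` for a regular vector `z`. -/
theorem acyclicOn_univ [Finite W] (hW : IsEssentialReflectionGroup W) (R : Type*) [CommRing R]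
    {k : ℕ} (hk : k < Module.finrank ℝ V) :
    OrderComplex.AcyclicOn R (Set.univ : Set (ProperPart W)) k := by
  have hV : (whole W).space ≠ ⊥ := by
    intro h
    have h1 : Module.finrank ℝ (whole W).space = Module.finrank ℝ V := finrank_top ℝ V
    rw [h, finrank_bot] at h1
    omega
  obtain ⟨z, hz⟩ := exists_regular W
  have key : ∀ (i j : W) (X : IntersectionLattice W), 2 ≤ Module.finrank ℝ V → i ≠ j →
      inner ℝ ((i : V ≃ₗᵢ[ℝ] V) z) z ≤ inner ℝ ((j : V ≃ₗᵢ[ℝ] V) z) z → i⁻¹ * j ∈ X.parabolic →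
      ∃ H : IntersectionLattice W, ∃ hH : H.space ≠ ⊥, H ≤ X ∧
        (mk hW i H hH).dim + 1 = Module.finrank ℝ V ∧
        ∃ j' : W, inner ℝ ((i : V ≃ₗᵢ[ℝ] V) z) z < inner ℝ ((j' : V ≃ₗᵢ[ℝ] V) z) z ∧
          mk hW j' (whole W) hV ≤ mk hW i H hH := by
    intro i j X hn hij hle hX
    obtain ⟨a, ha, haX, hlt⟩ := exists_refl_of_le hW.generated hz (Y := X.space) i.2
      (i⁻¹ * j).2 hX (fun h => hij (inv_mul_eq_one.1 (Subtype.ext h))) (by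
        have : (i : V ≃ₗᵢ[ℝ] V) (((i⁻¹ * j : W) : V ≃ₗᵢ[ℝ] V) z) = (j : V ≃ₗᵢ[ℝ] V) z :=
          (i : V ≃ₗᵢ[ℝ] V).apply_symm_apply _
        rwa [this])
    have hdim := finrank_space_ofRoot ha
    have hH : (ofRoot a ha).space ≠ ⊥ := by
      intro h
      rw [h, finrank_bot] at hdim
      omega
    refine ⟨ofRoot a ha, hH, fun x hx => (mem_space_ofRoot ha).2 (haX x hx), ?_,
      i * (⟨refl a, ha.2⟩ : W), hlt, ?_⟩
    · rw [dim, type_mk, hdim]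
    · rw [mk_whole_le_iff, mem_mk, inv_mul_cancel_left]
      exact le_refl (fix (refl a))
  refine OrderComplex.acyclicOn_univ_of_height dim (exists_join hW)
    (fun w : W => mk hW w (whole W) hV) (fun w => inner ℝ ((w : V ≃ₗᵢ[ℝ] V) z) z)
    (Module.finrank ℝ V) ?_ ?_ ?_ ?_ hk
  · intro w
    rw [dim, type_mk]
    exact finrank_top ℝ V
  · intro C
    obtain ⟨w, hw⟩ := C.exists_mem
    exact ⟨w, mk_whole_le_iff.2 hw⟩
  · intro hn i j hij hle
    obtain ⟨H, hH, -, h1, h2⟩ := key i j (IntersectionLattice.zero hW) hn hij hle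
      (by rw [(parabolic_eq_top_iff hW).2 rfl]; trivial)
    refine ⟨mk hW i H hH, ?_, h1, h2⟩
    rw [mk_whole_le_iff]
    exact self_mem_mk _ _ _
  · intro i j C hij hle hi hj
    rw [mk_whole_le_iff] at hi hj
    have hmem : i⁻¹ * j ∈ C.type.parabolic := by
      rwa [eq_smul_of_mem hi, mem_smul_parabolic] at hj
    have hn : 2 ≤ Module.finrank ℝ V := by
      -- in dimension one every proper coset is a single element
      by_contra hlt
      have h1 := C.dim_pos hW
      have h2 : C.type.space = ⊤ :=
        Submodule.eq_top_of_finrank_eq (by have := C.dim_le; simp only [dim] at *; omega)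
      rw [mem_parabolic, h2] at hmem
      refine hij (inv_mul_eq_one.1 (Subtype.ext (LinearIsometryEquiv.ext fun x => ?_)))
      exact hmem (Submodule.mem_top (x := x))
    obtain ⟨H, hH, hHX, h1, h2⟩ := key i j C.type hn hij hle hmem
    refine ⟨mk hW i H hH, ?_, ?_, h1, h2⟩
    · rw [mk_whole_le_iff]
      exact self_mem_mk _ _ _
    · rw [le_iff_of_mem (self_mem_mk _ _ _) hi, type_mk]
      exact hHX

end ProperPart

end ReflectionGroup

/-! ### Traces on chains, cycles and homology -/

/-- The trace of an endomorphism is the sum of its traces on an invariant subspace and on the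
quotient by it. -/
theorem LinearMap.trace_restrict_add_trace_mapQ {K M : Type*} [Field K] [AddCommGroup M]
    [Module K M] [FiniteDimensional K M] (f : M →ₗ[K] M) (p : Submodule K M)
    (hp : ∀ x ∈ p, f x ∈ p) :
    LinearMap.trace K p (f.restrict hp) + LinearMap.trace K (M ⧸ p) (p.mapQ p f hp) =
      LinearMap.trace K M f := by
  obtain ⟨π, hπ⟩ := p.subtype.exists_leftInverse_of_injective p.ker_subtype
  have hπ' : ∀ x : p, π x = x := fun x => LinearMap.congr_fun hπ x
  let e : M →ₗ[K] M := LinearMap.id - p.subtype ∘ₗ π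
  let s : M ⧸ p →ₗ[K] M := p.liftQ e fun x hx => by
    simp [e, hπ' ⟨x, hx⟩]
  have hs : ∀ x, s (Submodule.Quotient.mk x) = x - π x := fun x => rfl
  have h1 : f = (f ∘ₗ p.subtype) ∘ₗ π + (f ∘ₗ s) ∘ₗ p.mkQ := by
    ext x
    simp only [LinearMap.add_apply, LinearMap.comp_apply, Submodule.mkQ_apply, hs, map_sub,
      Submodule.subtype_apply]
    abel
  have h2 : π ∘ₗ f ∘ₗ p.subtype = f.restrict hp := by
    ext x
    exact congrArg Subtype.val (hπ' ⟨f x, hp x x.2⟩)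
  have h3 : p.mkQ ∘ₗ f ∘ₗ s = p.mapQ p f hp := by
    refine Submodule.linearMap_qext _ (LinearMap.ext fun x => ?_)
    simp only [LinearMap.comp_apply, Submodule.mkQ_apply, hs, map_sub, Submodule.mapQ_apply]
    rw [(Submodule.Quotient.mk_eq_zero p).2 (hp _ (π x).2), sub_zero]
  nth_rewrite 3 [h1]
  rw [map_add, LinearMap.trace_comp_comm' π, LinearMap.trace_comp_comm' p.mkQ, h2, h3]

theorem LinearMap.trace_mapQ_of_subsingleton {K M : Type*} [Field K] [AddCommGroup M]
    [Module K M] [FiniteDimensional K M] (f : M →ₗ[K] M) (p : Submodule K M)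
    (hp : ∀ x ∈ p, f x ∈ p) [Subsingleton p] :
    LinearMap.trace K (M ⧸ p) (p.mapQ p f hp) = LinearMap.trace K M f := by
  rw [← LinearMap.trace_restrict_add_trace_mapQ f p hp, Subsingleton.elim (f.restrict hp) 0,
    map_zero, zero_add]

theorem LinearMap.trace_restrict_congr {K M : Type*} [Field K] [AddCommGroup M] [Module K M]
    (f : M →ₗ[K] M) {p q : Submodule K M} (h : p = q) (hp : ∀ x ∈ p, f x ∈ p)
    (hq : ∀ x ∈ q, f x ∈ q) :
    LinearMap.trace K p (f.restrict hp) = LinearMap.trace K q (f.restrict hq) := by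
  subst h
  rfl

theorem LinearMap.trace_restrict_top {K M : Type*} [Field K] [AddCommGroup M] [Module K M]
    (f : M →ₗ[K] M) (h : ∀ x ∈ (⊤ : Submodule K M), f x ∈ (⊤ : Submodule K M)) :
    LinearMap.trace K (⊤ : Submodule K M) (f.restrict h) = LinearMap.trace K M f := by
  rw [← LinearMap.trace_conj' f Submodule.topEquiv.symm]
  rfl

/-- The trace of an endomorphism commuting with `g` is the sum of its traces on the kernel and on
the range of `g`. -/
theorem LinearMap.trace_restrict_ker_add_trace_restrict_range {K M N : Type*} [Field K]
    [AddCommGroup M] [Module K M] [AddCommGroup N] [Module K N] [FiniteDimensional K M]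
    (f : M →ₗ[K] M) (f' : N →ₗ[K] N) (g : M →ₗ[K] N) (h : ∀ x, g (f x) = f' (g x))
    (hker : ∀ x ∈ LinearMap.ker g, f x ∈ LinearMap.ker g)
    (hrange : ∀ x ∈ LinearMap.range g, f' x ∈ LinearMap.range g) :
    LinearMap.trace K (LinearMap.ker g) (f.restrict hker) +
      LinearMap.trace K (LinearMap.range g) (f'.restrict hrange) = LinearMap.trace K M f := by
  rw [← LinearMap.trace_restrict_add_trace_mapQ f (LinearMap.ker g) hker,
    ← LinearMap.trace_conj' _ g.quotKerEquivRange]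
  congr 2
  refine LinearMap.ext fun y => ?_
  obtain ⟨x, rfl⟩ := g.quotKerEquivRange.surjective y
  induction x using Submodule.Quotient.induction_on with
  | H x =>
    rw [LinearEquiv.conj_apply_apply, LinearEquiv.symm_apply_apply]
    refine Subtype.ext ?_
    simp only [Submodule.mapQ_apply, LinearMap.quotKerEquivRange_apply_mk,
      LinearMap.coe_restrict_apply, h]

theorem LinearMap.trace_lmapDomain {K α : Type*} [Field K] [Finite α] (g : α → α) :
    LinearMap.trace K (α →₀ K) (Finsupp.lmapDomain K K g) = Nat.card {a // g a = a} := by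
  classical
  have := Fintype.ofFinite α
  rw [LinearMap.trace_eq_matrix_trace K Finsupp.basisSingleOne, Matrix.trace,
    Nat.card_eq_fintype_card, Fintype.card_subtype, Finset.card_filter, Nat.cast_sum]
  refine Finset.sum_congr rfl fun a _ => ?_
  simp [LinearMap.toMatrix_apply, Finsupp.mapDomain_single, Finsupp.single_apply]

namespace OrderComplex

variable {K : Type*} [Field K] {P : Type*} [PartialOrder P]

theorem AcyclicOn.cycles_eq {R : Type*} [CommRing R] {k : ℕ}
    (h : AcyclicOn R (Set.univ : Set P) k) : cycles R P k = boundaries R P k := by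
  refine le_antisymm (fun z hz => ?_) (boundaries_le_cycles R P k)
  obtain ⟨y, -, hy⟩ := h z hz fun _ _ _ => Set.mem_univ _
  exact ⟨y, hy⟩

theorem finite_simplex [Finite P] (k : ℕ) : Finite (Simplex P k) :=
  Finite.of_injective (fun c : Simplex P k => (c : Fin k → P)) DFunLike.coe_injective

/-- The Hopf trace formula in the situation where the homology is concentrated in the top
degree. -/
theorem trace_homologyMap [Finite P] (n : ℕ)
    (hacyc : ∀ k < n, AcyclicOn K (Set.univ : Set P) k) [IsEmpty (Simplex P (n + 1))]
    (e : P ≃o P) :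
    LinearMap.trace K _ (homologyMap K n e) =
      (-1) ^ n * ∑ k ∈ Finset.range (n + 1),
        (-1) ^ k * (Nat.card {c : Simplex P k // c.trans e.toOrderEmbedding = c} : K) := by
  have hfin : ∀ k, Finite (Simplex P k) := finite_simplex
  have htr : ∀ k, LinearMap.trace K _ (chainMap K k e) =
      (Nat.card {c : Simplex P k // c.trans e.toOrderEmbedding = c} : K) := fun k =>
    LinearMap.trace_lmapDomain _
  simp_rw [← htr]
  have hB : boundaries K P n = ⊥ := by
    rw [boundaries, LinearMap.range_eq_bot]
    exact Subsingleton.elim _ _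
  have hcyc : ∀ m ≤ n, (-1) ^ m * LinearMap.trace K _
      ((chainMap K m e).restrict (chainMap_mem_cycles K m e)) =
      ∑ k ∈ Finset.range (m + 1), (-1) ^ k * LinearMap.trace K _ (chainMap K k e) := by
    intro m
    induction m with
    | zero =>
      intro _
      rw [Finset.sum_range_one]
      congr 1
      exact LinearMap.trace_restrict_top _ _
    | succ m ih =>
      intro hm
      have h : LinearMap.trace K (cycles K P (m + 1))
            ((chainMap K (m + 1) e).restrict (chainMap_mem_cycles K (m + 1) e)) +
          LinearMap.trace K (boundaries K P m)
            ((chainMap K m e).restrict (chainMap_mem_boundaries K m e)) =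
          LinearMap.trace K _ (chainMap K (m + 1) e) :=
        LinearMap.trace_restrict_ker_add_trace_restrict_range _ _ (boundary K P m)
          (boundary_chainMap K m e) _ _
      rw [Finset.sum_range_succ, ← ih (by omega), ← h,
        LinearMap.trace_restrict_congr _ (hacyc m (by omega)).cycles_eq _
          (chainMap_mem_boundaries K m e)]
      ring
  rw [← hcyc n le_rfl, ← mul_assoc, ← mul_pow]
  simp only [mul_neg, mul_one, neg_neg, one_pow, one_mul]
  have hsub : Subsingleton ((boundaries K P n).submoduleOf (cycles K P n)) := by
    rw [hB]
    refine ⟨fun x y => Subtype.ext (Subtype.ext ?_)⟩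
    have hx : (x.1 : Chains K P n) = 0 := x.2
    have hy : (y.1 : Chains K P n) = 0 := y.2
    rw [hx, hy]
  have h := LinearMap.trace_mapQ_of_subsingleton (M := cycles K P n)
    ((chainMap K n e).restrict (chainMap_mem_cycles K n e))
    ((boundaries K P n).submoduleOf (cycles K P n))
    (fun x hx => chainMap_mem_boundaries K n e x hx)
  exact h

end OrderComplex

/-! ### Counting chains and the Möbius function -/

namespace OrderComplex

variable {P : Type*} [PartialOrder P]

/-- The number of chains with `k + 1` elements and least element `a`. -/
noncomputable def chainCount (k : ℕ) (a : P) : ℕ := Nat.card {c : Simplex P (k + 1) // c 0 = a}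

theorem chainCount_zero (a : P) : chainCount 0 a = 1 := by
  rw [chainCount, Nat.card_eq_one_iff_unique]
  refine ⟨⟨fun c c' => Subtype.ext (DFunLike.ext _ _ fun i => ?_)⟩,
    ⟨⟨cons a default fun i => i.elim0, rfl⟩⟩⟩
  rw [show i = 0 from Fin.fin_one_eq_zero i, c.2, c'.2]

open scoped Classical in
theorem chainCount_succ [Fintype P] (k : ℕ) (a : P) :
    chainCount (k + 1) a = ∑ b with a < b, chainCount k b := by
  have hfin := finite_simplex (P := P) (k + 1)
  let E : {c : Simplex P (k + 2) // c 0 = a} ≃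
      Σ b : {b : P // a < b}, {c : Simplex P (k + 1) // c 0 = b} :=
    { toFun := fun c => ⟨⟨face 0 c.1 0, c.2.symm.trans_lt (lt_face_zero c.1 0)⟩, face 0 c.1, rfl⟩
      invFun := fun x => ⟨cons a x.2.1 fun i => (x.1.2.trans_eq x.2.2.symm).trans_le
        (x.2.1.monotone (Fin.zero_le i)), rfl⟩
      left_inv := by
        rintro ⟨c, rfl⟩
        exact Subtype.ext (cons_face_zero c)
      right_inv := by
        rintro ⟨⟨b, hb⟩, ⟨c, hc⟩⟩
        change c 0 = b at hc
        subst hc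
        rfl }
  rw [chainCount, Nat.card_congr E, Nat.card_sigma, Finset.sum_subtype _ (p := fun b => a < b)
    (by simp)]
  rfl

open scoped Classical in
/-- If the set of fixed points of `e` is an upper set, then the chains fixed by `e` are those whose
least element is fixed. -/
theorem card_fixed_simplex [Fintype P] (e : P ≃o P) (he : ∀ a b, a ≤ b → e a = a → e b = b)
    (k : ℕ) : Nat.card {c : Simplex P (k + 1) // c.trans e.toOrderEmbedding = c} =
      ∑ a with e a = a, chainCount k a := by
  have hfin := finite_simplex (P := P) (k + 1)
  have hfix : ∀ c : Simplex P (k + 1), c.trans e.toOrderEmbedding = c ↔ e (c 0) = c 0 :=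
    fun c => ⟨fun h => DFunLike.congr_fun h 0, fun h => DFunLike.ext _ _ fun i =>
      he _ _ (c.monotone (Fin.zero_le i)) h⟩
  let E : {c : Simplex P (k + 1) // c.trans e.toOrderEmbedding = c} ≃
      Σ a : {a : P // e a = a}, {c : Simplex P (k + 1) // c 0 = a} :=
    { toFun := fun c => ⟨⟨c.1 0, (hfix c.1).1 c.2⟩, c.1, rfl⟩
      invFun := fun x => ⟨x.2.1, (hfix _).2 (by rw [x.2.2]; exact x.1.2)⟩
      left_inv := fun _ => rfl
      right_inv := by
        rintro ⟨⟨b, hb⟩, ⟨c, hc⟩⟩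
        change c 0 = b at hc
        subst hc
        rfl }
  rw [Nat.card_congr E, Nat.card_sigma, Finset.sum_subtype _ (p := fun a => e a = a) (by simp)]
  rfl

/-- The alternating number of chains with at most `m` elements and least element `a`. -/
noncomputable def altChainCount (m : ℕ) (a : P) : ℤ :=
  ∑ k ∈ Finset.range m, (-1) ^ (k + 1) * (chainCount k a : ℤ)

open scoped Classical in
theorem altChainCount_succ [Fintype P] (m : ℕ) (a : P) :
    altChainCount (m + 1) a = -(1 + ∑ b with a < b, altChainCount m b) := by
  simp only [altChainCount]
  rw [Finset.sum_range_succ', chainCount_zero, Finset.sum_comm]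
  simp only [chainCount_succ, Nat.cast_sum, Finset.mul_sum]
  rw [neg_add, ← Finset.sum_neg_distrib, add_comm]
  congr 1
  refine Finset.sum_congr rfl fun k _ => ?_
  rw [← Finset.sum_neg_distrib]
  exact Finset.sum_congr rfl fun b _ => by ring

open scoped Classical in
theorem sum_card_fixed_simplex [Fintype P] (e : P ≃o P) (he : ∀ a b, a ≤ b → e a = a → e b = b)
    (n : ℕ) : ∑ k ∈ Finset.range (n + 1),
      (-1) ^ k * (Nat.card {c : Simplex P k // c.trans e.toOrderEmbedding = c} : ℤ) =
      1 + ∑ a with e a = a, altChainCount n a := by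
  rw [Finset.sum_range_succ', add_comm]
  congr 1
  · have : Nat.card {c : Simplex P 0 // c.trans e.toOrderEmbedding = c} = 1 := by
      rw [Nat.card_eq_one_iff_unique]
      exact ⟨inferInstance, ⟨⟨default, Subsingleton.elim _ _⟩⟩⟩
    rw [this]
    simp
  · simp only [altChainCount]
    rw [Finset.sum_comm]
    refine Finset.sum_congr rfl fun k _ => ?_
    rw [card_fixed_simplex e he, Nat.cast_sum, Finset.mul_sum]

end OrderComplex

namespace ReflectionGroup

variable {V : Type*} [NormedAddCommGroup V] [InnerProductSpace ℝ V]
  {W : Subgroup (V ≃ₗᵢ[ℝ] V)}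

open IntersectionLattice

theorem IntersectionLattice.moebius_of_space_eq_bot [Finite W] (hW : IsEssentialReflectionGroup W)
    {X : IntersectionLattice W} (hX : X.space = ⊥) : X.moebius hW = 1 := by
  have : X = IntersectionLattice.zero hW := space_injective hX
  classical
  rw [moebius, this, IncidenceAlgebra.mu_self]

open scoped Classical in
theorem IntersectionLattice.moebius_eq [Finite W] (hW : IsEssentialReflectionGroup W)
    {X : IntersectionLattice W} (hX : X.space ≠ ⊥) :
    X.moebius hW = -∑ Y with X < Y, Y.moebius hW := by
  have hne : X ≠ IntersectionLattice.zero hW := fun h => hX (congrArg space h)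
  rw [moebius, IncidenceAlgebra.mu_eq_neg_sum_Ioc_of_ne hne]
  congr 1
  refine Finset.sum_congr ?_ fun Y _ => rfl
  ext Y
  simp only [Finset.mem_Ioc, Finset.mem_filter, Finset.mem_univ, true_and, and_iff_left_iff_imp]
  exact fun _ => bot_le (a := Y.space)

namespace ProperPart

open scoped Classical in
/-- The cosets containing `C` correspond to the elements of the intersection lattice above its
type. -/
theorem sum_lt_eq (hW : IsEssentialReflectionGroup W) [Finite W] [Fintype (ProperPart W)]
    (C : ProperPart W) (g : IntersectionLattice W → ℤ) :
    ∑ D with C < D, g D.type = ∑ Y with C.type < Y ∧ Y.space ≠ ⊥, g Y := by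
  obtain ⟨w, hw⟩ := C.exists_mem
  refine Finset.sum_bij (fun D _ => D.type) ?_ ?_ ?_ fun _ _ => rfl
  · intro D hD
    simp only [Finset.mem_filter, Finset.mem_univ, true_and] at hD ⊢
    exact ⟨type_strictMono hD, D.type_space_ne_bot hW⟩
  · intro D hD D' hD' h
    simp only [Finset.mem_filter, Finset.mem_univ, true_and] at hD hD'
    refine Subtype.ext (Subtype.ext ?_)
    rw [eq_smul_of_mem (hD.le hw), eq_smul_of_mem (hD'.le hw), h]
  · intro Y hY
    simp only [Finset.mem_filter, Finset.mem_univ, true_and] at hY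
    refine ⟨mk hW w Y hY.2, ?_, type_mk _ _ _⟩
    simp only [Finset.mem_filter, Finset.mem_univ, true_and]
    rw [lt_iff_le_not_ge, le_iff_of_mem hw (self_mem_mk _ _ _),
      le_iff_of_mem (self_mem_mk _ _ _) hw, type_mk]
    exact lt_iff_le_not_ge.1 hY.1

/-- Philip Hall's theorem for the intervals above proper parabolic cosets. -/
theorem altChainCount_eq (hW : IsEssentialReflectionGroup W) [Finite W] [FiniteDimensional ℝ V]
    (m : ℕ) (C : ProperPart W) (hC : C.dim ≤ m) :
    OrderComplex.altChainCount m C = C.type.moebius hW := by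
  classical
  have := Fintype.ofFinite (ProperPart W)
  induction m generalizing C with
  | zero => exact absurd (C.dim_pos hW) (by omega)
  | succ m ih =>
    rw [OrderComplex.altChainCount_succ, moebius_eq hW (C.type_space_ne_bot hW)]
    congr 1
    have h1 : ∑ b with C < b, OrderComplex.altChainCount m b =
        ∑ D with C < D, D.type.moebius hW :=
      Finset.sum_congr rfl fun D hD => ih D (by
        have := dim_strictAnti (Finset.mem_filter.1 hD).2
        omega)
    rw [h1, sum_lt_eq hW C fun Y => Y.moebius hW,
      ← Finset.sum_filter_add_sum_filter_not (Finset.univ.filter fun Y => C.type < Y)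
        (fun Y => Y.space ≠ ⊥), Finset.filter_filter, add_comm]
    congr 1
    have h2 : ((Finset.univ.filter fun Y => C.type < Y).filter fun Y => ¬ Y.space ≠ ⊥) =
        {IntersectionLattice.zero hW} := by
      ext Y
      simp only [Finset.mem_filter, Finset.mem_univ, true_and, not_not, Finset.mem_singleton]
      constructor
      · rintro ⟨-, h⟩
        exact space_injective h
      · rintro rfl
        refine ⟨lt_of_le_of_ne (bot_le (a := C.type.space)) fun h => ?_, rfl⟩
        exact C.type_space_ne_bot hW (congrArg space h)
    rw [h2, Finset.sum_singleton, moebius_of_space_eq_bot hW rfl]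

theorem leftMul_apply_eq_iff {w : W} {C : ProperPart W} {u : W} (hu : u ∈ C.1.1) :
    leftMul W w C = C ↔ u⁻¹ * (w * u) ∈ C.type.parabolic := by
  have h : leftMul W w C = C ↔ w • C.1.1 = C.1.1 :=
    ⟨fun h => congrArg (fun D : ProperPart W => D.1.1) h, fun h => Subtype.ext (Subtype.ext h)⟩
  rw [h, eq_smul_of_mem hu, smul_smul, ← mem_smul_parabolic]
  constructor
  · intro h
    rw [← h, mem_smul_parabolic, inv_mul_cancel]
    exact one_mem _
  · intro h
    exact (smul_parabolic_eq_of_mem h).symm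

theorem leftMul_apply_eq_of_le {w : W} {C D : ProperPart W} (hCD : C ≤ D)
    (h : leftMul W w C = C) : leftMul W w D = D := by
  obtain ⟨u, hu⟩ := C.exists_mem
  rw [leftMul_apply_eq_iff hu] at h
  rw [leftMul_apply_eq_iff (hCD hu)]
  exact parabolic_le_iff.2 (type_mono hCD) h

/-- The fixed points of `w` among the cosets of `W_X`. -/
theorem card_fixed_type (hW : IsEssentialReflectionGroup W) (w : W)
    (X : IntersectionLattice W) (hX : X.space ≠ ⊥) :
    Nat.card {C : ProperPart W // leftMul W w C = C ∧ C.type = X} =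
      Nat.card {q : W ⧸ X.parabolic // w • q = q} := by
  have hfix : ∀ u : W, leftMul W w (mk hW u X hX) = mk hW u X hX ↔
      w • (u : W ⧸ X.parabolic) = u := by
    intro u
    rw [leftMul_apply_eq_iff (self_mem_mk _ _ _), type_mk, eq_comm (b := (u : W ⧸ X.parabolic))]
    exact QuotientGroup.eq.symm
  refine (Nat.card_eq_of_bijective (fun q : {q : W ⧸ X.parabolic // w • q = q} =>
    (⟨mk hW q.1.out X hX, (hfix _).2 (by rw [QuotientGroup.out_eq']; exact q.2),
      type_mk _ _ _⟩ : {C : ProperPart W // leftMul W w C = C ∧ C.type = X})) ⟨?_, ?_⟩).symm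
  · intro q q' h
    have h1 : mk hW q.1.out X hX = mk hW q'.1.out X hX := congrArg Subtype.val h
    have h2 : q'.1.out ∈ (mk hW q.1.out X hX).1.1 := by rw [h1]; exact self_mem_mk _ _ _
    rw [mem_mk, ← QuotientGroup.eq, QuotientGroup.out_eq', QuotientGroup.out_eq'] at h2
    exact Subtype.ext h2
  · rintro ⟨C, hC, rfl⟩
    obtain ⟨u, hu⟩ := C.exists_mem
    have hmem : (u : W ⧸ C.type.parabolic).out ∈ C.1.1 := by
      rw [eq_smul_of_mem hu, mem_smul_parabolic, ← QuotientGroup.eq, QuotientGroup.out_eq']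
    refine ⟨⟨(u : W ⧸ C.type.parabolic), ?_⟩, Subtype.ext (eq_mk_of_mem hW hmem).symm⟩
    rw [← hfix, ← eq_mk_of_mem hW hu]
    exact hC

end ProperPart

end ReflectionGroup

/-! ### The character induced from the trivial character -/

namespace Representation

open scoped MonoidAlgebra

variable {k G : Type*} [Field k] [Group G] (H : Subgroup G)

/-- The linear map `Ind_H^G 1 → k[G ⧸ H]`, `⟦g ⊗ a⟧ ↦ a • g⁻¹H`. The inverse accounts for Mathlib's
model of the induced representation as coinvariants of `k[G]` under left multiplication. -/
noncomputable def indTrivialToFinsupp :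
    IndV H.subtype (trivial k H k) →ₗ[k] (G ⧸ H →₀ k) :=
  Coinvariants.lift _ (Finsupp.lmapDomain k k (fun g : G => ((g⁻¹ : G) : G ⧸ H)) ∘ₗ
    (MonoidAlgebra.coeffLinearEquiv k).toLinearMap ∘ₗ (_root_.TensorProduct.rid k k[G]).toLinearMap)
    fun s => by
      refine TensorProduct.ext (MonoidAlgebra.lhom_ext' fun g => LinearMap.ext_ring
        (LinearMap.ext_ring ?_))
      simp [Finsupp.mapDomain_single]

theorem indTrivialToFinsupp_mk (g : G) (a : k) :
    indTrivialToFinsupp H (IndV.mk H.subtype (trivial k H k) g a) =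
      Finsupp.single ((g⁻¹ : G) : G ⧸ H) a := by
  simp [indTrivialToFinsupp, Finsupp.mapDomain_single]

theorem indV_mk_mul (s : H) (g : G) :
    IndV.mk H.subtype (trivial k H k) (s * g) = IndV.mk H.subtype (trivial k H k) g := by
  refine LinearMap.ext_ring ?_
  have h := Coinvariants.mk_self_apply (tprod ((leftRegular k G).comp H.subtype) (trivial k H k)) s
    (TensorProduct.tmul k (MonoidAlgebra.single g 1) (1 : k))
  simpa using h

theorem indV_mk_eq {g h : G} (hgh : ((g⁻¹ : G) : G ⧸ H) = (h⁻¹ : G)) :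
    IndV.mk H.subtype (trivial k H k) g = IndV.mk H.subtype (trivial k H k) h := by
  have hmem : g * h⁻¹ ∈ H := by simpa using QuotientGroup.eq.1 hgh
  rw [← indV_mk_mul H ⟨g * h⁻¹, hmem⟩ h]
  simp

/-- The representation induced from the trivial representation of `H` is the permutation
representation on `G ⧸ H`. -/
noncomputable def indTrivialEquiv : IndV H.subtype (trivial k H k) ≃ₗ[k] (G ⧸ H →₀ k) :=
  LinearEquiv.ofLinearMap (indTrivialToFinsupp H)
    (Finsupp.lsum k fun q => IndV.mk H.subtype (trivial k H k) (q.out⁻¹))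
    (by
      refine Finsupp.lhom_ext fun q a => ?_
      rw [LinearMap.comp_apply, Finsupp.lsum_single, indTrivialToFinsupp_mk, inv_inv,
        QuotientGroup.out_eq']
      rfl)
    (by
      refine IndV.hom_ext _ _ fun g => LinearMap.ext fun a => ?_
      rw [LinearMap.comp_apply, LinearMap.comp_apply, indTrivialToFinsupp_mk, Finsupp.lsum_single,
        indV_mk_eq H (h := g) (by rw [inv_inv, QuotientGroup.out_eq'])]
      rfl)

theorem character_ind_trivial [Finite G] (g : G) :
    (ind H.subtype (trivial k H k)).character g = Nat.card {q : G ⧸ H // g • q = q} := by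
  rw [character, ← LinearMap.trace_conj' _ (indTrivialEquiv H),
    ← LinearMap.trace_lmapDomain (K := k) fun q : G ⧸ H => g • q]
  congr 1
  refine Finsupp.lhom_ext fun q a => ?_
  have h : (indTrivialEquiv (k := k) H).symm (Finsupp.single q a) =
      IndV.mk H.subtype (trivial k H k) (q.out⁻¹) a :=
    Finsupp.lsum_single k (fun q : G ⧸ H => IndV.mk H.subtype (trivial k H k) (q.out⁻¹)) q a
  rw [LinearEquiv.conj_apply_apply, h, ind_mk, Finsupp.lmapDomain_apply,
    Finsupp.mapDomain_single]
  refine (indTrivialToFinsupp_mk H _ a).trans ?_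
  rw [mul_inv_rev, inv_inv, inv_inv]
  congr 1
  conv_rhs => rw [← QuotientGroup.out_eq' q]
  rfl

end Representation

/-! ### The action of the group on its intersection lattice -/

namespace ReflectionGroup

variable {V : Type*} [NormedAddCommGroup V] [InnerProductSpace ℝ V]
  {W : Subgroup (V ≃ₗᵢ[ℝ] V)}

namespace IntersectionLattice

theorem map_mem_hyperplanes (w : W) {H : Submodule ℝ V} (hH : H ∈ hyperplanes W) :
    H.map ((w : V ≃ₗᵢ[ℝ] V).toLinearEquiv : V →ₗ[ℝ] V) ∈ hyperplanes W := by
  obtain ⟨t, ht, ht', rfl⟩ := hH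
  obtain ⟨a, ha, rfl⟩ := exists_root_of_isReflection ht ht'
  have hwa := map_mem_roots w.2 ha
  refine ⟨_, hwa.2, isReflection_refl hwa.1, ?_⟩
  ext x
  obtain ⟨y, rfl⟩ := (w : V ≃ₗᵢ[ℝ] V).surjective x
  have h1 : (w : V ≃ₗᵢ[ℝ] V) y ∈
      (fix (refl a)).map ((w : V ≃ₗᵢ[ℝ] V).toLinearEquiv : V →ₗ[ℝ] V) ↔ y ∈ fix (refl a) :=
    ⟨fun ⟨y', hy', h⟩ => (w : V ≃ₗᵢ[ℝ] V).injective h ▸ hy', fun hy => ⟨y, hy, rfl⟩⟩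
  rw [h1]
  change refl a y = y ↔ refl _ _ = _
  rw [refl_eq_self_iff ha.1, refl_eq_self_iff hwa.1, LinearIsometryEquiv.inner_map_map]

/-- `W` acts on its intersection lattice by `X ↦ w X`. -/
instance : MulAction W (IntersectionLattice W) where
  smul w X :=
    { space := X.space.map ((w : V ≃ₗᵢ[ℝ] V).toLinearEquiv : V →ₗ[ℝ] V)
      exists_eq_sInf := by
        obtain ⟨S, hS, hX⟩ := X.exists_eq_sInf
        refine ⟨Submodule.map ((w : V ≃ₗᵢ[ℝ] V).toLinearEquiv : V →ₗ[ℝ] V) '' S, ?_, ?_⟩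
        · rintro _ ⟨H, hH, rfl⟩
          exact map_mem_hyperplanes w (hS hH)
        · rw [hX, sInf_image]
          exact (Submodule.orderIsoMapComap (w : V ≃ₗᵢ[ℝ] V).toLinearEquiv).map_sInf S }
  one_smul X := space_injective (Submodule.map_id X.space)
  mul_smul u w X := space_injective (Submodule.map_comp _ _ X.space)

theorem smul_space (w : W) (X : IntersectionLattice W) :
    (w • X).space = X.space.map ((w : V ≃ₗᵢ[ℝ] V).toLinearEquiv : V →ₗ[ℝ] V) := rfl

theorem smul_le_smul (w : W) {X Y : IntersectionLattice W} (h : X ≤ Y) : w • X ≤ w • Y :=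
  Submodule.map_mono (f := ((w : V ≃ₗᵢ[ℝ] V).toLinearEquiv : V →ₗ[ℝ] V)) h

theorem smul_lt_smul_iff (w : W) {X Y : IntersectionLattice W} : w • X < w • Y ↔ X < Y := by
  have h : ∀ X Y : IntersectionLattice W, w • X ≤ w • Y ↔ X ≤ Y := fun X Y =>
    ⟨fun h => by simpa using smul_le_smul w⁻¹ h, smul_le_smul w⟩
  rw [lt_iff_le_not_ge, lt_iff_le_not_ge, h, h]

theorem mem_parabolic_smul {u w : W} {X : IntersectionLattice W} :
    u ∈ (w • X).parabolic ↔ w⁻¹ * u * w ∈ X.parabolic := by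
  have h : ∀ v : V, ((w⁻¹ * u * w : W) : V ≃ₗᵢ[ℝ] V) v = v ↔
      (u : V ≃ₗᵢ[ℝ] V) ((w : V ≃ₗᵢ[ℝ] V) v) = (w : V ≃ₗᵢ[ℝ] V) v := fun v =>
    LinearIsometryEquiv.symm_apply_eq (w : V ≃ₗᵢ[ℝ] V)
  constructor
  · intro hu v hv
    exact (h v).2 (hu ⟨v, hv, rfl⟩)
  · rintro hu _ ⟨v, hv, rfl⟩
    exact (h v).1 (hu hv)

/-- As `X` is determined by `W_X`, its stabilizer is the normalizer of `W_X`. -/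
theorem stabilizer_eq_normalizer (X : IntersectionLattice W) :
    MulAction.stabilizer W X = Subgroup.normalizer (X.parabolic : Set W) := by
  ext w
  rw [MulAction.mem_stabilizer_iff, Subgroup.mem_normalizer_iff'', ← parabolic_injective.eq_iff,
    SetLike.ext_iff]
  refine forall_congr' fun u => ?_
  rw [mem_parabolic_smul]
  exact iff_comm

theorem space_eq_bot_smul_iff (w : W) {X : IntersectionLattice W} :
    (w • X).space = ⊥ ↔ X.space = ⊥ := by
  rw [smul_space]
  exact Submodule.map_eq_bot_iff (e := (w : V ≃ₗᵢ[ℝ] V).toLinearEquiv)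

theorem moebius_smul [Finite W] (hW : IsEssentialReflectionGroup W) (w : W)
    (X : IntersectionLattice W) : (w • X).moebius hW = X.moebius hW := by
  classical
  induction X using WellFoundedGT.induction with
  | ind X ih =>
    by_cases hX : X.space = ⊥
    · rw [moebius_of_space_eq_bot hW hX,
        moebius_of_space_eq_bot hW ((space_eq_bot_smul_iff w).2 hX)]
    · rw [moebius_eq hW hX, moebius_eq hW fun h => hX ((space_eq_bot_smul_iff w).1 h)]
      congr 1
      refine (Finset.sum_equiv (MulAction.toPerm w) (fun Y => ?_) fun Y hY => ?_).symm
      · simp [smul_lt_smul_iff]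
      · exact (ih Y (Finset.mem_filter.1 hY).2).symm

theorem phi_eq [Finite W] (X : IntersectionLattice W) (w : W) :
    X.phi w = Nat.card {q : W ⧸ X.parabolic // w • q = q} :=
  Representation.character_ind_trivial X.parabolic w

theorem phi_of_space_eq_bot [Finite W] (hW : IsEssentialReflectionGroup W)
    {X : IntersectionLattice W} (hX : X.space = ⊥) (w : W) : X.phi w = 1 := by
  have h := (parabolic_eq_top_iff hW).2 hX
  have hsub : Subsingleton (W ⧸ X.parabolic) := by
    rw [h]
    exact QuotientGroup.subsingleton_quotient_top
  rw [phi_eq, (Nat.card_eq_one_iff_unique (α := {q : W ⧸ X.parabolic // w • q = q})).2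
    ⟨inferInstance, ⟨⟨((1 : W) : W ⧸ X.parabolic), Subsingleton.elim _ _⟩⟩⟩, Nat.cast_one]

theorem smul_eq_self_iff (w : W) {X : IntersectionLattice W} (g : W) :
    w • (g : W ⧸ X.parabolic) = g ↔ g⁻¹ * w * g ∈ X.parabolic := by
  rw [eq_comm, mul_assoc]
  exact QuotientGroup.eq

/-- Right translation by `u` maps the cosets of `W_{uX}` fixed by `w` injectively to those of `W_X`.
-/
theorem card_fixed_smul_le [Finite W] (u w : W) (X : IntersectionLattice W) :
    Nat.card {q : W ⧸ (u • X).parabolic // w • q = q} ≤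
      Nat.card {q : W ⧸ X.parabolic // w • q = q} := by
  refine Nat.card_le_card_of_injective (fun q : {q : W ⧸ (u • X).parabolic // w • q = q} =>
    (⟨((q.1.out * u : W) : W ⧸ X.parabolic), ?_⟩ : {q : W ⧸ X.parabolic // w • q = q})) ?_
  · have h := q.2
    rw [← QuotientGroup.out_eq' q.1, smul_eq_self_iff, mem_parabolic_smul] at h
    rw [smul_eq_self_iff]
    convert h using 1
    group
  · intro q q' h
    have h1 : ((q.1.out * u : W) : W ⧸ X.parabolic) = ((q'.1.out * u : W) : W ⧸ X.parabolic) :=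
      congrArg Subtype.val h
    rw [QuotientGroup.eq] at h1
    refine Subtype.ext ?_
    rw [← QuotientGroup.out_eq' q.1, ← QuotientGroup.out_eq' q'.1, QuotientGroup.eq,
      mem_parabolic_smul]
    convert h1 using 1
    group

theorem phi_smul [Finite W] (u w : W) (X : IntersectionLattice W) : (u • X).phi w = X.phi w := by
  rw [phi_eq, phi_eq]
  congr 1
  refine le_antisymm (card_fixed_smul_le u w X) ?_
  have h := card_fixed_smul_le u⁻¹ w (u • X)
  rwa [inv_smul_smul] at h

/-- By the orbit-stabilizer theorem, summing a `W`-invariant function over the intersection lattice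
amounts to summing it over orbit representatives, weighted by the indices of the normalizers. -/
theorem IsOrbitTransversal.sum_eq [Finite W] {Θ : Finset (IntersectionLattice W)}
    (hΘ : IsOrbitTransversal Θ) (g : IntersectionLattice W → ℂ)
    (hg : ∀ (w : W) (X : IntersectionLattice W), g (w • X) = g X) :
    ∑ X, g X =
      ∑ X ∈ Θ, ((Subgroup.normalizer (X.parabolic : Set W)).index : ℂ) * g X := by
  classical
  choose r hr hr' using hΘ
  have horb : ∀ X, ∃ w : W, r X = w • X := fun X => by
    obtain ⟨w, hw, h⟩ := (hr X).2
    exact ⟨⟨w, hw⟩, space_injective h⟩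
  rw [← Finset.sum_fiberwise_of_maps_to (s := Finset.univ) (t := Θ) (g := r)
    (fun X _ => (hr X).1)]
  refine Finset.sum_congr rfl fun Y hY => ?_
  have hfib : ∀ X, r X = Y ↔ X ∈ MulAction.orbit W Y := by
    intro X
    constructor
    · rintro rfl
      obtain ⟨w, hw⟩ := horb X
      exact ⟨w⁻¹, by rw [hw]; exact inv_smul_smul w X⟩
    · rintro ⟨w, rfl⟩
      refine (hr' _ Y ⟨hY, (w⁻¹ : W), (w⁻¹ : W).2, ?_⟩).symm
      rw [← smul_space]
      exact congrArg space (inv_smul_smul w Y).symm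
  have hconst : ∀ X ∈ Finset.univ.filter (fun X => r X = Y), g X = g Y := by
    intro X hX
    obtain ⟨w, rfl⟩ := (hfib X).1 (Finset.mem_filter.1 hX).2
    exact hg w Y
  rw [Finset.sum_congr rfl hconst, Finset.sum_const, nsmul_eq_mul, ← stabilizer_eq_normalizer,
    MulAction.index_stabilizer, ← Set.ncard_coe_finset]
  congr 3
  ext X
  simpa using hfib X

end IntersectionLattice

open IntersectionLattice

/-- The character formula as a sum over the whole intersection lattice. -/
theorem homologyCharacter_eq [FiniteDimensional ℝ V] [Finite W]
    (hW : IsEssentialReflectionGroup W) (w : W) :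
    homologyCharacter W (Module.finrank ℝ V) w = (-1) ^ Module.finrank ℝ V *
      ∑ X : IntersectionLattice W, (X.moebius hW : ℂ) * X.phi w := by
  classical
  have := Fintype.ofFinite (ProperPart W)
  have hempty := ProperPart.isEmpty_simplex hW (k := Module.finrank ℝ V + 1) (by omega)
  have htrace := OrderComplex.trace_homologyMap (K := ℂ) (Module.finrank ℝ V)
    (fun k hk => ProperPart.acyclicOn_univ hW ℂ hk) (leftMul W w)
  obtain ⟨S, hS, hcount⟩ : ∃ S : Finset (ProperPart W), (∀ C, C ∈ S ↔ leftMul W w C = C) ∧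
      ∑ k ∈ Finset.range (Module.finrank ℝ V + 1), (-1) ^ k *
        (Nat.card {c : OrderComplex.Simplex (ProperPart W) k //
          c.trans (leftMul W w).toOrderEmbedding = c} : ℤ) =
      1 + ∑ C ∈ S, OrderComplex.altChainCount (Module.finrank ℝ V) C := by
    refine ⟨_, fun C => ?_, OrderComplex.sum_card_fixed_simplex (leftMul W w)
      (fun _ _ h => ProperPart.leftMul_apply_eq_of_le h) (Module.finrank ℝ V)⟩
    simp only [Finset.mem_filter, Finset.mem_univ, true_and]
  refine htrace.trans ?_
  congr 1
  have hcount' := congrArg (Int.cast : ℤ → ℂ) hcount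
  push_cast at hcount'
  rw [hcount']
  have hmu : ∀ C : ProperPart W, OrderComplex.altChainCount (Module.finrank ℝ V) C =
      C.type.moebius hW := fun C => ProperPart.altChainCount_eq hW _ C C.dim_le
  simp only [hmu]
  rw [← Finset.sum_fiberwise S (fun C : ProperPart W => C.type),
    ← Finset.add_sum_erase _ _ (Finset.mem_univ (IntersectionLattice.zero hW)),
    ← Finset.add_sum_erase _ (fun X : IntersectionLattice W => (X.moebius hW : ℂ) * X.phi w)
      (Finset.mem_univ (IntersectionLattice.zero hW))]
  rw [moebius_of_space_eq_bot hW rfl, phi_of_space_eq_bot hW rfl, Int.cast_one, one_mul]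
  -- the zero subspace is not the type of a proper coset; its term is the `1` of the empty chain
  rw [Finset.sum_eq_zero (s := Finset.filter _ _), zero_add]
  · congr 1
    refine Finset.sum_congr rfl fun X hX => ?_
    have hX' : X.space ≠ ⊥ := fun h => Finset.ne_of_mem_erase hX (space_injective h)
    rw [phi_eq, ← ProperPart.card_fixed_type hW w X hX', Nat.card_eq_fintype_card,
      Fintype.card_subtype]
    have hset : Finset.univ.filter (fun C => leftMul W w C = C ∧ C.type = X) =
        S.filter fun C => C.type = X := by
      ext C
      simp [hS]
    rw [hset]
    rw [Finset.sum_congr rfl (g := fun _ => (X.moebius hW : ℂ)) fun C hC => by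
      rw [(Finset.mem_filter.1 hC).2], Finset.sum_const, nsmul_eq_mul, mul_comm]
  · intro C hC
    exact absurd (congrArg space (Finset.mem_filter.1 hC).2) (C.type_space_ne_bot hW)

end ReflectionGroup

theorem theorem2 {V : Type*} [NormedAddCommGroup V] [InnerProductSpace ℝ V]
    [FiniteDimensional ℝ V] (n : ℕ) (hn : Module.finrank ℝ V = n)
    (W : Subgroup (V ≃ₗᵢ[ℝ] V)) [Finite W] (hW : ReflectionGroup.IsEssentialReflectionGroup W) :
    (∀ w : W, ReflectionGroup.homologyCharacter W n w =
      (-1) ^ n * ∑ X : ReflectionGroup.IntersectionLattice W, (X.moebius hW : ℂ) * X.phi w) ∧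
    ∀ Θ : Finset (ReflectionGroup.IntersectionLattice W),
      ReflectionGroup.IntersectionLattice.IsOrbitTransversal Θ →
      ∀ w : W, ReflectionGroup.homologyCharacter W n w =
        (-1) ^ n * ∑ X ∈ Θ, (X.moebius hW : ℂ) *
          ((Subgroup.normalizer (X.parabolic : Set W)).index : ℂ) * X.phi w := by
  subst hn
  refine ⟨ReflectionGroup.homologyCharacter_eq hW, fun Θ hΘ w => ?_⟩
  rw [ReflectionGroup.homologyCharacter_eq hW w, hΘ.sum_eq _ fun u X => by
    rw [ReflectionGroup.IntersectionLattice.moebius_smul,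
      ReflectionGroup.IntersectionLattice.phi_smul]]
  congr 1
  exact Finset.sum_congr rfl fun X _ => by ring
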